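/- Let $\alpha\in(0,1)$ be irrational with continued fraction expansion $\alpha=[a_1,a_2,\ldots]$, and let $q_n$ be the denominators of its convergents, i.e. $q_{-1}=0$, $q_0=1$ and $q_{n+1}=a_{n+1}q_n+q_{n-1}$ for $n\ge 0$. Let $\mathbb T=\mathbb R/\mathbb Z$ (identified with $[0,1)$) carry Lebesgue measure $\lambda$, let $R_\alpha(x)=x+\alpha \bmod 1$, let $\phi(x)=\frac1x+\frac1{1-x}$ for $x\in(0,1)$ (the value at the single point $0$ being irrelevant), and let $S_N(\phi)(x)=\sum_{k=0}^{N-1}\phi(R_\alpha^k x)$. For $n\ge 1$ with $q_n>1$ put $$W_n=W_n(\alpha)=\begin{cases}\dfrac{\log q_{n+1}-\log q_n}{\log q_n}&\text{if } q_{n+1}<2q_n\log q_n,\\[2ex] \dfrac{\max\left\{1,\ \log\log q_n-\log\log\frac{q_{n+1}}{q_n\log q_n}\right\}}{\log q_n}&\text{if } q_{n+1}\ge 2q_n\log q_n,\end{cases}$$ and put $W_n=0$ if $q_n=1$ (for $n\ge1$ this happens only if $n=1$ and $a_1=1$). All $W_n$ are non-negative. Then: 1. if $\sum_{n=1}^\infty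 W_n<\infty$, then $\displaystyle\limsup_{N\to\infty}\frac{\phi(R_\alpha^N x)}{S_N(\phi)(x)}=0$ for $\lambda$-almost every $x\in\mathbb T$; 2. if $\sum_{n=1}^\infty W_n=\infty$, then $\displaystyle\limsup_{N\to\infty}\frac{\phi(R_\alpha^N x)}{S_N(\phi)(x)}=\infty$ for $\lambda$-almost every $x\in\mathbb T$. -/

import Mathlib

noncomputable section

/-- The observable `φ(x) = 1/x + 1/(1-x)` on the one-torus `ℝ/ℤ`, where a point of the torus is
identified with its representative in `[0, 1)`. (At the single point `0`, a null set, the real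
value is the conventional `1`.) -/
def phi (x : UnitAddCircle) : ℝ :=
  1 / (AddCircle.equivIco (1 : ℝ) 0 x : ℝ) + 1 / (1 - (AddCircle.equivIco (1 : ℝ) 0 x : ℝ))

/-- The rotation `R_α(x) = x + α mod 1` on the one-torus. -/
def torusRotation (α : ℝ) (x : UnitAddCircle) : UnitAddCircle :=
  x + (α : UnitAddCircle)

/-- The denominator `q_n` of the `n`-th convergent of the continued fraction of `α`
(`q_0 = 1`, `q_1 = a_1`, `q_{n+1} = a_{n+1} q_n + q_{n-1}`), as a real number. -/
def cfDen (α : ℝ) (n : ℕ) : ℝ :=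
  (GenContFract.of α).dens n

open Classical in
/-- The quantity `W_n(α)`. If `q_n = 1` (which for `n ≥ 1` means `n = 1` and `a_1 = 1`), the
formula divides by `log 1 = 0`, and the value is `0`. -/
def W (α : ℝ) (n : ℕ) : ℝ :=
  if cfDen α (n + 1) < 2 * cfDen α n * Real.log (cfDen α n) then
    (Real.log (cfDen α (n + 1)) - Real.log (cfDen α n)) / Real.log (cfDen α n)
  else
    max 1 (Real.log (Real.log (cfDen α n)) -
        Real.log (Real.log (cfDen α (n + 1) / (cfDen α n * Real.log (cfDen α n))))) /
      Real.log (cfDen α n)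

/-- The extravagance `limsup_N φ(R_α^N x) / S_N(φ)(x)` as an extended real number, where
`S_N(φ)(x) = ∑_{k < N} φ(R_α^k x)` is the Birkhoff sum. -/
def extravagance (α : ℝ) (x : UnitAddCircle) : EReal :=
  Filter.limsup
    (fun N : ℕ => ((phi ((torusRotation α)^[N] x) / birkhoffSum (torusRotation α) phi N x : ℝ) : EReal))
    Filter.atTop

end

/-!
Since `1 / ‖x‖ ≤ φ(x) ≤ 2 / ‖x‖`, the term `φ(R_α^N x)` exceeds `ε S_N(φ)(x)` exactly when, up to
constants, `‖x + N α‖` is at most `1 / (ε S_N)`. For `q_n ≤ N < q_{n+1}` the sum `S_N` has two main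
parts: the separation of the orbit at scale `1 / q_n` yields `N log q_n`, and, if `x + N α` is close
to `0`, the points `x + (N - j q_n) α` yield about `q_{n+1} log (N / q_n)`. The first part
dominates from `N ≈ Z log Z · q_n` on, where `Z = q_{n+1} / (q_n log q_n)`. Hence the set of `x`
with `φ(R_α^N x) > ε S_N(φ)(x)` has measure about `1 / (N log q_n)` for later and
`1 / (q_{n+1} log (N / q_n))` for earlier times `N`, and these measures add up to about `W_n`.

If `∑ W_n` converges, the Borel–Cantelli lemma applies. If it diverges, so does the sum of the
measures over the later times alone, up to a telescoping series. The corresponding unions of small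
balls about `-N α` are quasi-independent, because these centres are equidistributed at the scale
`1 / q_{n-1}`, so by the Kochen–Stone lemma their upper limit has positive measure. By ergodicity
almost every orbit enters the upper limit, at a time `k`, and the difference `S_k(φ)(x)` of
`S_{N+k}(φ)(x)` and `S_N(φ)(R_α^k x)` is negligible as `N → ∞`.
-/

/-- The sequences of numerators `p n` and denominators `q n` of the convergents of `α`, reduced to
the relations between them on which the distribution of the orbits of the rotation by `α` depends.
The indexing is that of `GenContFract`, so `q 0 = 1`; only the inequality
`q n + q (n + 1) ≤ q (n + 2)` is kept from the recurrence. -/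
structure IsConvergentSeq (α : ℝ) (p : ℕ → ℤ) (q : ℕ → ℕ) : Prop where
  pos : ∀ n, 0 < q n
  le_succ : ∀ n, q n ≤ q (n + 1)
  add_le : ∀ n, q n + q (n + 1) ≤ q (n + 2)
  abs_det : ∀ n, |p n * q (n + 1) - q n * p (n + 1)| = 1
  abs_sub_le : ∀ n, |q n * α - p n| ≤ 1 / q (n + 1)

section ContinuedFraction

variable {K : Type*} [Field K] [LinearOrder K] [FloorRing K]

theorem not_terminatedAt_of_irrational {α : ℝ} (hα : Irrational α) (n : ℕ) :
    ¬(GenContFract.of α).TerminatedAt n := fun h =>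
  let ⟨r, hr⟩ := (GenContFract.terminates_iff_rat α).1 ⟨n, h⟩
  hα ⟨r, hr.symm⟩

theorem exists_int_contsAux_of (v : K) (n : ℕ) :
    (∃ a b : ℤ, (GenContFract.of v).contsAux n = ⟨a, b⟩) ∧
      ∃ a b : ℤ, (GenContFract.of v).contsAux (n + 1) = ⟨a, b⟩ := by
  induction n with
  | zero => exact ⟨⟨1, 0, by simp⟩, ⌊v⌋, 1, by simp [GenContFract.of_h_eq_floor]⟩
  | succ n ih =>
    obtain ⟨⟨a, b, hab⟩, c, d, hcd⟩ := ih
    refine ⟨⟨c, d, hcd⟩, ?_⟩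
    rcases hs : (GenContFract.of v).s.get? n with _ | gp
    · exact ⟨c, d, by rw [← hcd]; exact GenContFract.contsAux_stable_step_of_terminated hs⟩
    · obtain ⟨hone, z, hz⟩ := GenContFract.of_partNum_eq_one_and_exists_int_partDen_eq hs
      exact ⟨z * c + a, z * d + b, by
        simp [GenContFract.contsAux_recurrence hs hab hcd, hone, hz]⟩

variable [IsStrictOrderedRing K]

theorem exists_int_nums_nat_dens_of (v : K) (n : ℕ) :
    ∃ (a : ℤ) (b : ℕ), (GenContFract.of v).nums n = a ∧ (GenContFract.of v).dens n = b := by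
  obtain ⟨a, b, hab⟩ := (exists_int_contsAux_of v n).2
  have hden : (GenContFract.of v).dens n = b := by
    rw [GenContFract.den_eq_conts_b, GenContFract.nth_cont_eq_succ_nth_contAux, hab]
  have hb : (0 : K) ≤ b := hden ▸ GenContFract.zero_le_of_den
  lift b to ℕ using by exact_mod_cast hb
  exact ⟨a, b, by
    rw [GenContFract.num_eq_conts_a, GenContFract.nth_cont_eq_succ_nth_contAux, hab],
    by exact_mod_cast hden⟩

theorem dens_add_dens_le_of_not_terminatedAt {v : K} {n : ℕ}
    (h : ¬(GenContFract.of v).TerminatedAt (n + 1)) :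
    (GenContFract.of v).dens n + (GenContFract.of v).dens (n + 1) ≤
      (GenContFract.of v).dens (n + 2) := by
  obtain ⟨gp, hs⟩ : ∃ gp, (GenContFract.of v).s.get? (n + 1) = some gp :=
    Option.ne_none_iff_exists'.1 h
  have hb : 1 ≤ gp.b := GenContFract.of_one_le_get?_partDen (GenContFract.partDen_eq_s_b hs)
  have hden : 0 ≤ (GenContFract.of v).dens (n + 1) := GenContFract.zero_le_of_den
  rw [GenContFract.dens_recurrence hs rfl rfl,
    (GenContFract.of_partNum_eq_one_and_exists_int_partDen_eq hs).1]
  nlinarith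

theorem one_le_dens_of (v : K) (n : ℕ) :
    1 ≤ (GenContFract.of v).dens n := by
  simpa using monotone_nat_of_le_succ (fun m => GenContFract.of_den_mono (v := v) (n := m))
    (Nat.zero_le n)

theorem abs_dens_mul_sub_nums_le {v : K} {n : ℕ}
    (h : ¬(GenContFract.of v).TerminatedAt n) :
    |(GenContFract.of v).dens n * v - (GenContFract.of v).nums n| ≤
      1 / (GenContFract.of v).dens (n + 1) := by
  have hconv := GenContFract.abs_sub_convs_le h
  rw [GenContFract.conv_eq_num_div_den] at hconv
  have h0 : 0 < (GenContFract.of v).dens n := one_pos.trans_le (one_le_dens_of v n)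
  have h1 : 0 < (GenContFract.of v).dens (n + 1) := one_pos.trans_le (one_le_dens_of v (n + 1))
  calc |(GenContFract.of v).dens n * v - (GenContFract.of v).nums n|
      = (GenContFract.of v).dens n *
          |v - (GenContFract.of v).nums n / (GenContFract.of v).dens n| := by
        rw [← abs_of_pos h0, ← abs_mul, abs_of_pos h0, mul_sub, mul_div_cancel₀ _ h0.ne']
    _ ≤ (GenContFract.of v).dens n *
          (1 / ((GenContFract.of v).dens n * (GenContFract.of v).dens (n + 1))) := by gcongr
    _ = 1 / (GenContFract.of v).dens (n + 1) := by field_simp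

theorem exists_isConvergentSeq {α : ℝ} (hα : Irrational α) :
    ∃ (p : ℕ → ℤ) (q : ℕ → ℕ), IsConvergentSeq α p q ∧ ∀ n, cfDen α n = q n := by
  choose p q hp hq using exists_int_nums_nat_dens_of α
  have hnt := not_terminatedAt_of_irrational hα
  refine ⟨p, q, ⟨fun n => ?_, fun n => ?_, fun n => ?_, fun n => ?_, fun n => ?_⟩, hq⟩
  · exact_mod_cast one_pos.trans_le (hq n ▸ one_le_dens_of α n)
  · have h := GenContFract.of_den_mono (v := α) (n := n)
    rw [hq, hq] at h
    exact_mod_cast h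
  · have h := dens_add_dens_le_of_not_terminatedAt (hnt (n + 1))
    rw [hq, hq, hq] at h
    exact_mod_cast h
  · have h : (GenContFract.of α).nums n * (GenContFract.of α).dens (n + 1) -
        (GenContFract.of α).dens n * (GenContFract.of α).nums (n + 1) = (-1) ^ (n + 1) :=
      SimpContFract.determinant (s := SimpContFract.of α) (hnt n)
    rw [hp, hp, hq, hq] at h
    have hdet : p n * q (n + 1) - q n * p (n + 1) = (-1) ^ (n + 1) := by exact_mod_cast h
    rw [hdet, abs_pow, abs_neg, abs_one, one_pow]
  · have h := abs_dens_mul_sub_nums_le (hnt n)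
    rwa [hp, hq, hq] at h

end ContinuedFraction

theorem mul_nonpos_of_abs_sub_eq_one {a b : ℝ} (ha : |a| ≤ 1) (hb : |b| ≤ 1)
    (hab : |a - b| = 1) : a * b ≤ 0 := by
  rw [abs_le] at ha hb
  rcases (abs_eq zero_le_one).1 hab with h | h <;> nlinarith

theorem abs_le_abs_int_combination {e f : ℝ} {u v : ℤ} (hef : e * f ≤ 0) (hu : u ≠ 0)
    (huv : u * v ≤ 0) : |e| ≤ |u * e + v * f| := by
  have hu1 : (1 : ℝ) ≤ |(u : ℝ)| := by exact_mod_cast Int.one_le_abs hu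
  have hcross : (0 : ℝ) ≤ (u * e) * (v * f) := by
    have huv' : (u * v : ℝ) ≤ 0 := by exact_mod_cast huv
    nlinarith [mul_nonneg_of_nonpos_of_nonpos huv' hef]
  calc |e| ≤ |(u : ℝ)| * |e| := le_mul_of_one_le_left (abs_nonneg e) hu1
    _ = |u * e| := (abs_mul _ _).symm
    _ ≤ |u * e + v * f| := by rw [← sq_le_sq]; nlinarith [sq_nonneg ((v : ℝ) * f)]

/-- The pairs `(b, p)` and `(b', p')` form a basis of `ℤ²`. The coordinates of `(j, m)` in it have
opposite signs because `0 < j < b'`, so their contributions to `j α - m` do not cancel. -/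
theorem abs_mul_sub_le_of_abs_det_eq_one {α : ℝ} {b p b' p' : ℤ} (hb : 0 < b)
    (hdet : |p * b' - b * p'| = 1) (hopp : (b * α - p) * (b' * α - p') ≤ 0) {j : ℤ} (m : ℤ)
    (hj : 0 < j) (hj' : j < b') : |b * α - p| ≤ |j * α - m| := by
  set s : ℤ := p * b' - b * p'
  have hs2 : s * s = 1 := by rw [← abs_mul_abs_self, hdet, one_mul]
  set u : ℤ := s * (m * b' - j * p')
  set v : ℤ := s * (j * p - m * b)
  have hj_eq : j = u * b + v * b' := by linear_combination -j * hs2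
  have hm_eq : m = u * p + v * p' := by linear_combination -m * hs2
  have hcomb : (j : ℝ) * α - m = u * (b * α - p) + v * (b' * α - p') := by
    rw [hj_eq, hm_eq]; push_cast; ring
  have hb' : 0 < b' := hj.trans hj'
  rw [hcomb]
  refine abs_le_abs_int_combination hopp (fun hu0 => ?_) ?_
  · have hjv : j = v * b' := by rw [hj_eq, hu0, zero_mul, zero_add]
    have hv0 : 0 < v := pos_of_mul_pos_left (hjv ▸ hj) hb'.le
    nlinarith
  · by_contra! huv
    rcases pos_and_pos_or_neg_and_neg_of_mul_pos huv with ⟨hu0, hv0⟩ | ⟨hu0, hv0⟩ <;> nlinarith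

namespace IsConvergentSeq

variable {α : ℝ} {p : ℕ → ℤ} {q : ℕ → ℕ}

theorem monotone (H : IsConvergentSeq α p q) : Monotone q := monotone_nat_of_le_succ H.le_succ

theorem one_le_cast (H : IsConvergentSeq α p q) (n : ℕ) : (1 : ℝ) ≤ q n := by
  exact_mod_cast H.pos n

theorem cast_pos (H : IsConvergentSeq α p q) (n : ℕ) : (0 : ℝ) < q n := by
  exact_mod_cast H.pos n

theorem abs_error_det (H : IsConvergentSeq α p q) (n : ℕ) :
    |q (n + 1) * (q n * α - p n) - q n * (q (n + 1) * α - p (n + 1))| = 1 := by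
  have h : (|p n * q (n + 1) - q n * p (n + 1)| : ℝ) = 1 := by exact_mod_cast H.abs_det n
  rw [← h, ← abs_neg]
  congr 1
  ring

theorem cast_succ_mul_abs_error_le (H : IsConvergentSeq α p q) (n : ℕ) :
    q (n + 1) * |q n * α - p n| ≤ 1 := by
  rw [mul_comm, ← le_div_iff₀ (H.cast_pos _)]
  exact H.abs_sub_le n

theorem cast_mul_error_mul_cast_mul_error_nonpos (H : IsConvergentSeq α p q) (n : ℕ) :
    (q (n + 1) * (q n * α - p n)) * (q n * (q (n + 1) * α - p (n + 1))) ≤ 0 := by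
  refine mul_nonpos_of_abs_sub_eq_one ?_ ?_ (H.abs_error_det n)
  · rw [abs_mul, Nat.abs_cast]
    exact H.cast_succ_mul_abs_error_le n
  · rw [abs_mul, Nat.abs_cast]
    refine le_trans ?_ (H.cast_succ_mul_abs_error_le (n + 1))
    gcongr
    exact H.monotone (by lia)

theorem error_mul_error_nonpos (H : IsConvergentSeq α p q) (n : ℕ) :
    (q n * α - p n) * (q (n + 1) * α - p (n + 1)) ≤ 0 := by
  have h := H.cast_mul_error_mul_cast_mul_error_nonpos n
  rw [mul_mul_mul_comm] at h
  exact nonpos_of_mul_nonpos_right h (mul_pos (H.cast_pos _) (H.cast_pos _))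

theorem cast_succ_mul_abs_error_add (H : IsConvergentSeq α p q) (n : ℕ) :
    q (n + 1) * |q n * α - p n| + q n * |q (n + 1) * α - p (n + 1)| = 1 := by
  have h := H.abs_error_det n
  have hsign := neg_nonneg.2 (H.cast_mul_error_mul_cast_mul_error_nonpos n)
  rw [← mul_neg] at hsign
  rw [sub_eq_add_neg, (abs_add_eq_add_abs_iff _ _).2 (mul_nonneg_iff.1 hsign), abs_neg] at h
  simpa only [abs_mul, Nat.abs_cast] using h

theorem abs_error_succ_le (H : IsConvergentSeq α p q) (n : ℕ) :
    |q (n + 1) * α - p (n + 1)| ≤ |q n * α - p n| := by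
  have hadd : (q n + q (n + 1) : ℝ) ≤ q (n + 2) := by exact_mod_cast H.add_le n
  refine le_of_mul_le_mul_left ?_ (H.cast_pos (n + 1))
  nlinarith [H.cast_succ_mul_abs_error_add n, H.cast_succ_mul_abs_error_le (n + 1),
    mul_le_mul_of_nonneg_right hadd (abs_nonneg (q (n + 1) * α - p (n + 1)))]

theorem one_div_two_mul_le_abs_error (H : IsConvergentSeq α p q) (n : ℕ) :
    1 / (2 * q (n + 1)) ≤ |q n * α - p n| := by
  have hle : (q n : ℝ) ≤ q (n + 1) := by exact_mod_cast H.le_succ n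
  have hq := H.cast_pos (n + 1)
  rw [div_le_iff₀ (by positivity)]
  nlinarith [H.cast_succ_mul_abs_error_add n, abs_nonneg (q n * α - p n),
    mul_le_mul hle (H.abs_error_succ_le n) (abs_nonneg _) hq.le]

theorem one_div_two_mul_le_norm (H : IsConvergentSeq α p q) (n : ℕ) {j : ℕ} (hj : 0 < j)
    (hj' : j < q (n + 1)) : 1 / (2 * q (n + 1)) ≤ ‖j • (α : UnitAddCircle)‖ := by
  have hopp := H.error_mul_error_nonpos n
  rw [← AddCircle.coe_nsmul, nsmul_eq_mul, UnitAddCircle.norm_eq]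
  refine (H.one_div_two_mul_le_abs_error n).trans ?_
  exact_mod_cast abs_mul_sub_le_of_abs_det_eq_one (α := α) (b := q n) (b' := q (n + 1))
    (by exact_mod_cast H.pos n) (H.abs_det n) (by exact_mod_cast hopp) (j := j)
    (round (j * α)) (by exact_mod_cast hj) (by exact_mod_cast hj')

theorem isCoprime (H : IsConvergentSeq α p q) (n : ℕ) : IsCoprime (p n) (q n : ℤ) := by
  rcases (abs_eq zero_le_one).1 (H.abs_det n) with h | h
  · exact ⟨q (n + 1), -p (n + 1), by linear_combination h⟩
  · exact ⟨-q (n + 1), p (n + 1), by linear_combination -h⟩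

theorem two_mul_le (H : IsConvergentSeq α p q) (n : ℕ) : 2 * q n ≤ q (n + 2) := by
  have := H.add_le n
  have := H.le_succ n
  lia

theorem le_self (H : IsConvergentSeq α p q) (n : ℕ) : n ≤ q n := by
  induction n using Nat.twoStepInduction with
  | zero => exact Nat.zero_le _
  | one => exact H.pos 1
  | more n _ ih =>
    have := H.add_le n
    have := H.pos n
    lia

end IsConvergentSeq

section Circle

theorem exists_coe_eq_and_abs_eq_norm (x : UnitAddCircle) :
    ∃ u : ℝ, (u : UnitAddCircle) = x ∧ |u| = ‖x‖ := by
  obtain ⟨r, rfl⟩ := QuotientAddGroup.mk_surjective x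
  refine ⟨r - round r, ?_, UnitAddCircle.norm_eq.symm⟩
  rw [AddCircle.coe_sub, sub_eq_self, AddCircle.coe_eq_zero_iff]
  exact ⟨round r, by simp⟩

theorem norm_coe_of_mem_Ico {r : ℝ} (hr : r ∈ Set.Ico 0 1) :
    ‖(r : UnitAddCircle)‖ = min r (1 - r) := by
  rw [UnitAddCircle.norm_eq, abs_sub_round_eq_min, Int.fract_eq_self.2 hr]

theorem exists_mem_Ico_coe_eq (x : UnitAddCircle) :
    ∃ r ∈ Set.Ico (0 : ℝ) 1, (r : UnitAddCircle) = x := by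
  simpa using AddCircle.eq_coe_Ico (p := (1 : ℝ)) x

theorem phi_coe_of_mem_Ico {r : ℝ} (hr : r ∈ Set.Ico 0 1) :
    phi (r : UnitAddCircle) = 1 / r + 1 / (1 - r) := by
  rw [phi, AddCircle.equivIco_coe_eq (by simpa using hr)]

theorem one_div_norm_le_phi {x : UnitAddCircle} (hx : x ≠ 0) : 1 / ‖x‖ ≤ phi x := by
  obtain ⟨r, hr, rfl⟩ := exists_mem_Ico_coe_eq x
  have hr0 : 0 < r := hr.1.lt_of_ne' (by rintro rfl; simp at hx)
  have hr1 : 0 < 1 - r := sub_pos.2 hr.2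
  have := one_div_pos.2 hr0
  have := one_div_pos.2 hr1
  rw [phi_coe_of_mem_Ico hr, norm_coe_of_mem_Ico hr]
  rcases min_choice r (1 - r) with h | h <;> rw [h] <;> linarith

theorem phi_le_two_div_norm {x : UnitAddCircle} (hx : x ≠ 0) : phi x ≤ 2 / ‖x‖ := by
  obtain ⟨r, hr, rfl⟩ := exists_mem_Ico_coe_eq x
  have hr0 : 0 < r := hr.1.lt_of_ne' (by rintro rfl; simp at hx)
  have hmin : 0 < min r (1 - r) := lt_min hr0 (sub_pos.2 hr.2)
  rw [phi_coe_of_mem_Ico hr, norm_coe_of_mem_Ico hr]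
  calc 1 / r + 1 / (1 - r) ≤ 1 / min r (1 - r) + 1 / min r (1 - r) := by
        gcongr <;> simp
    _ = 2 / min r (1 - r) := by ring

theorem one_le_phi (x : UnitAddCircle) : 1 ≤ phi x := by
  obtain ⟨r, hr, rfl⟩ := exists_mem_Ico_coe_eq x
  have h : 1 ≤ 1 / (1 - r) := by
    rw [le_div_iff₀ (sub_pos.2 hr.2)]
    linarith [hr.1]
  rw [phi_coe_of_mem_Ico hr]
  linarith [one_div_nonneg.2 hr.1]

theorem torusRotation_iterate (α : ℝ) (k : ℕ) (x : UnitAddCircle) :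
    (torusRotation α)^[k] x = x + k • (α : UnitAddCircle) :=
  congrFun (add_right_iterate (α : UnitAddCircle) k) x

theorem birkhoffSum_torusRotation (α : ℝ) (N : ℕ) (x : UnitAddCircle) :
    birkhoffSum (torusRotation α) phi N x =
      ∑ k ∈ Finset.range N, phi (x + k • (α : UnitAddCircle)) := by
  simp only [birkhoffSum, torusRotation_iterate]

theorem natCast_le_birkhoffSum_phi (f : UnitAddCircle → UnitAddCircle) (N : ℕ)
    (x : UnitAddCircle) : (N : ℝ) ≤ birkhoffSum f phi N x := by
  simpa [birkhoffSum] using Finset.card_nsmul_le_sum (Finset.range N) (fun k => phi (f^[k] x)) 1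
    fun _ _ => one_le_phi _

theorem monotone_birkhoffSum_phi (f : UnitAddCircle → UnitAddCircle) (x : UnitAddCircle) :
    Monotone fun N => birkhoffSum f phi N x := fun _ _ h =>
  Finset.sum_le_sum_of_subset_of_nonneg (Finset.range_subset_range.2 h)
    fun _ _ _ => zero_le_one.trans (one_le_phi _)

theorem mul_le_birkhoffSum_mul {X : Type*} {f : X → X} {g : X → ℝ} {c : ℝ} {n : ℕ} {x : X}
    (h : ∀ m, c ≤ birkhoffSum f g n (f^[m] x)) (b : ℕ) : b * c ≤ birkhoffSum f g (b * n) x := by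
  induction b with
  | zero => simp
  | succ b ih =>
    rw [add_mul, one_mul, birkhoffSum_add]
    push_cast
    linarith [h (b * n)]

end Circle

section Separated

variable {ι : Type*} {F : Finset ι}

theorem sum_inv_natCast_le_harmonic {F : Finset ℕ} (hF : 0 ∉ F) :
    ∑ k ∈ F, (k : ℚ)⁻¹ ≤ harmonic F.card := by
  induction F using Finset.induction_on_max with
  | empty => simp
  | insert a s hmax ih =>
    have ha : a ∉ s := fun h => (hmax a h).false
    have hcard : s.card + 1 ≤ a := by
      have hsub : s ⊆ Finset.Ico 1 a := fun k hk => Finset.mem_Ico.2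
        ⟨Nat.one_le_iff_ne_zero.2 fun h => hF (by simp [← h, hk]), hmax k hk⟩
      have := Finset.card_le_card hsub
      have : a ≠ 0 := fun h => hF (by simp [h])
      rw [Nat.card_Ico] at *
      omega
    rw [Finset.sum_insert ha, Finset.card_insert_of_notMem ha, harmonic_succ, add_comm]
    gcongr
    exact ih fun h => hF (Finset.mem_insert_of_mem h)

theorem sum_one_div_natCast_le {F : Finset ℕ} {K : ℕ} (hF : 0 ∉ F) (hK : F.card ≤ K) :
    ∑ k ∈ F, (1 : ℝ) / k ≤ 1 + Real.log K := by
  have h : ∑ k ∈ F, (k : ℚ)⁻¹ ≤ harmonic K :=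
    (sum_inv_natCast_le_harmonic hF).trans <| Finset.sum_le_sum_of_subset_of_nonneg
      (Finset.range_subset_range.2 hK) fun _ _ _ => by positivity
  have h' : ∑ k ∈ F, (1 : ℝ) / k ≤ harmonic K := by
    simpa only [one_div, Rat.cast_sum, Rat.cast_inv, Rat.cast_natCast] using
      (Rat.cast_le (K := ℝ)).2 h
  exact h'.trans (harmonic_le_one_add_log K)

theorem injOn_floor_div_of_pairwise {s : Set ι} {u : ι → ℝ} {δ : ℝ} (hδ : 0 < δ)
    (hu : s.Pairwise fun i j => δ ≤ |u i - u j|) : s.InjOn fun i => ⌊u i / δ⌋ := by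
  intro i hi j hj hij
  by_contra hne
  have h := Int.abs_sub_lt_one_of_floor_eq_floor hij
  rw [← sub_div, abs_div, abs_of_pos hδ, div_lt_one hδ] at h
  exact h.not_ge (hu hi hj hne)

theorem sum_one_div_le_of_pairwise {u : ι → ℝ} {δ : ℝ} {K : ℕ} (hδ : 0 < δ)
    (hpos : ∀ i ∈ F, δ ≤ u i) (hu : (F : Set ι).Pairwise fun i j => δ ≤ |u i - u j|)
    (hK : F.card ≤ K) : ∑ i ∈ F, 1 / u i ≤ 1 / δ * (1 + Real.log K) := by
  classical
  have hone : ∀ i ∈ F, 1 ≤ u i / δ := fun i hi => (one_le_div hδ).2 (hpos i hi)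
  have hfloor : ∀ i ∈ F, 1 ≤ ⌊u i / δ⌋₊ := fun i hi => Nat.le_floor (by simpa using hone i hi)
  have hfloor_eq : ∀ i ∈ F, ⌊u i / δ⌋ = ⌊u i / δ⌋₊ := fun i hi =>
    (Int.natCast_floor_eq_floor (zero_le_one.trans (hone i hi))).symm
  have hinj : Set.InjOn (fun i => ⌊u i / δ⌋₊) (F : Set ι) := fun i hi j hj hij =>
    injOn_floor_div_of_pairwise hδ hu hi hj <|
      (hfloor_eq i hi).trans <| (congrArg _ hij).trans (hfloor_eq j hj).symm
  calc ∑ i ∈ F, 1 / u i ≤ ∑ i ∈ F, 1 / δ * (1 / (⌊u i / δ⌋₊ : ℝ)) := by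
        refine Finset.sum_le_sum fun i hi => ?_
        have hk : (0 : ℝ) < ⌊u i / δ⌋₊ := by exact_mod_cast hfloor i hi
        rw [one_div_mul_one_div]
        gcongr
        exact (le_div_iff₀' hδ).1 (Nat.floor_le (zero_le_one.trans (hone i hi)))
    _ = 1 / δ * ∑ m ∈ F.image fun i => ⌊u i / δ⌋₊, 1 / (m : ℝ) := by
        rw [← Finset.mul_sum, Finset.sum_image hinj]
    _ ≤ 1 / δ * (1 + Real.log K) := by
        gcongr
        refine sum_one_div_natCast_le (fun h => ?_) (Finset.card_image_le.trans hK)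
        obtain ⟨i, hi, h0⟩ := Finset.mem_image.1 h
        exact (Nat.one_le_iff_ne_zero.1 (hfloor i hi)) h0

theorem sum_one_div_abs_le_of_pairwise {u : ι → ℝ} {δ : ℝ} {K : ℕ} (hδ : 0 < δ)
    (habs : ∀ i ∈ F, δ ≤ |u i|) (hu : (F : Set ι).Pairwise fun i j => δ ≤ |u i - u j|)
    (hK : F.card ≤ K) : ∑ i ∈ F, 1 / |u i| ≤ 2 / δ * (1 + Real.log K) := by
  have hcard (P : ι → Prop) [DecidablePred P] : (F.filter P).card ≤ K :=
    (Finset.card_filter_le _ _).trans hK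
  have hsep (P : ι → Prop) [DecidablePred P] :
      (F.filter P : Set ι).Pairwise fun i j => δ ≤ |u i - u j| :=
    hu.mono (Finset.coe_subset.2 (Finset.filter_subset _ _))
  have hnonneg : ∑ i ∈ F with 0 ≤ u i, 1 / |u i| ≤ 1 / δ * (1 + Real.log K) := by
    rw [Finset.sum_congr rfl fun i hi => by rw [abs_of_nonneg (Finset.mem_filter.1 hi).2]]
    refine sum_one_div_le_of_pairwise hδ (fun i hi => ?_) (hsep _) (hcard _)
    rw [Finset.mem_filter] at hi
    exact abs_of_nonneg hi.2 ▸ habs i hi.1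
  have hneg : ∑ i ∈ F with ¬0 ≤ u i, 1 / |u i| ≤ 1 / δ * (1 + Real.log K) := by
    rw [Finset.sum_congr rfl fun i hi => by
      rw [abs_of_neg (not_le.1 (Finset.mem_filter.1 hi).2)]]
    refine sum_one_div_le_of_pairwise hδ (fun i hi => ?_) (fun i hi j hj hij => ?_) (hcard _)
    · rw [Finset.mem_filter, not_le] at hi
      exact abs_of_neg hi.2 ▸ habs i hi.1
    · simpa only [neg_sub_neg, abs_sub_comm] using hsep _ hi hj hij
  rw [← Finset.sum_filter_add_sum_filter_not F fun i => 0 ≤ u i]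
  linarith [show 2 / δ * (1 + Real.log K) = 2 * (1 / δ * (1 + Real.log K)) by ring]

theorem card_le_of_abs_le_of_pairwise {u : ι → ℝ} {δ R : ℝ} (hδ : 0 < δ) (hR : 0 ≤ R)
    (habs : ∀ i ∈ F, |u i| ≤ R) (hu : (F : Set ι).Pairwise fun i j => δ ≤ |u i - u j|) :
    (F.card : ℝ) ≤ 2 * R / δ + 2 := by
  have hRδ : -(R / δ) ≤ R / δ := neg_le_self (by positivity)
  have hcard : F.card ≤ (Finset.Icc ⌊-(R / δ)⌋ ⌊R / δ⌋).card := by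
    refine Finset.card_le_card_of_injOn _ (fun i hi => ?_) (injOn_floor_div_of_pairwise hδ hu)
    have h := abs_le.1 (habs i hi)
    rw [← neg_div]
    exact Finset.mem_coe.2 <| Finset.mem_Icc.2 ⟨Int.floor_le_floor (by gcongr; exact h.1),
      Int.floor_le_floor (by gcongr; exact h.2)⟩
  have hIcc : ((Finset.Icc ⌊-(R / δ)⌋ ⌊R / δ⌋).card : ℝ) = ⌊R / δ⌋ + 1 - ⌊-(R / δ)⌋ := by
    exact_mod_cast Int.card_Icc_of_le _ _ (by linarith [Int.floor_le_floor hRδ])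
  have hcard' : (F.card : ℝ) ≤ ⌊R / δ⌋ + 1 - ⌊-(R / δ)⌋ := hIcc ▸ by exact_mod_cast hcard
  rw [mul_div_assoc]
  linarith [Int.floor_le (R / δ), Int.lt_floor_add_one (-(R / δ))]

theorem exists_lift_of_pairwise_norm {z : ι → UnitAddCircle} {δ : ℝ} {s : Set ι}
    (hz : s.Pairwise fun i j => δ ≤ ‖z i - z j‖) :
    ∃ u : ι → ℝ, (∀ i, |u i| = ‖z i‖) ∧ s.Pairwise fun i j => δ ≤ |u i - u j| := by
  choose u hu hnorm using fun i => exists_coe_eq_and_abs_eq_norm (z i)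
  refine ⟨u, hnorm, hz.mono' fun i j hij => hij.trans ?_⟩
  rw [← hu, ← hu, ← AddCircle.coe_sub]
  exact QuotientAddGroup.norm_mk_le_norm

theorem sum_one_div_norm_le_of_pairwise {z : ι → UnitAddCircle} {δ : ℝ} {K : ℕ} (hδ : 0 < δ)
    (hnorm : ∀ i ∈ F, δ ≤ ‖z i‖) (hz : (F : Set ι).Pairwise fun i j => δ ≤ ‖z i - z j‖)
    (hK : F.card ≤ K) : ∑ i ∈ F, 1 / ‖z i‖ ≤ 2 / δ * (1 + Real.log K) := by
  obtain ⟨u, hu, hsep⟩ := exists_lift_of_pairwise_norm hz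
  simp only [← hu] at hnorm ⊢
  exact sum_one_div_abs_le_of_pairwise hδ hnorm hsep hK

theorem card_le_of_norm_le_of_pairwise {z : ι → UnitAddCircle} {δ R : ℝ} (hδ : 0 < δ)
    (hR : 0 ≤ R) (hnorm : ∀ i ∈ F, ‖z i‖ ≤ R)
    (hz : (F : Set ι).Pairwise fun i j => δ ≤ ‖z i - z j‖) : (F.card : ℝ) ≤ 2 * R / δ + 2 := by
  obtain ⟨u, hu, hsep⟩ := exists_lift_of_pairwise_norm hz
  exact card_le_of_abs_le_of_pairwise hδ hR (fun i hi => hu i ▸ hnorm i hi) hsep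

end Separated

section Blocks

variable {E : Type*} [SeminormedAddCommGroup E] {z : ℕ → E} {Q : ℕ} {δ : ℝ}

theorem card_filter_norm_lt_le_of_pairwise (hQ : 0 < Q)
    (hz : ∀ b, (Set.Ico (b * Q) (b * Q + Q)).Pairwise fun j k => 2 * δ ≤ ‖z j - z k‖) (N : ℕ) :
    ((Finset.range N).filter fun k => ‖z k‖ < δ).card ≤ N / Q + 1 := by
  rw [← Finset.card_range (N / Q + 1)]
  refine Finset.card_le_card_of_injOn (fun k => k / Q) (fun k hk => ?_) (fun j hj k hk hjk => ?_)
  · have hkN := Finset.mem_range.1 (Finset.mem_filter.1 hk).1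
    exact Finset.mem_coe.2 (Finset.mem_range_succ_iff.2 (Nat.div_le_div_right hkN.le))
  · by_contra hne
    have hblock (i : ℕ) : i ∈ Set.Ico (i / Q * Q) (i / Q * Q + Q) :=
      ⟨Nat.div_mul_le_self i Q, Nat.lt_div_mul_add hQ⟩
    have hjk : j / Q = k / Q := hjk
    have hsep := hz (k / Q) (hjk ▸ hblock j) (hblock k) hne
    linarith [norm_sub_le (z j) (z k), (Finset.mem_filter.1 hj).2, (Finset.mem_filter.1 hk).2]

theorem sum_filter_one_div_norm_le_of_pairwise {z : ℕ → UnitAddCircle} (hQ : 0 < Q) (hδ : 0 < δ)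
    (hz : ∀ b, (Set.Ico (b * Q) (b * Q + Q)).Pairwise fun j k => δ ≤ ‖z j - z k‖) (N : ℕ) :
    ∑ k ∈ Finset.range N with ¬‖z k‖ < δ, 1 / ‖z k‖ ≤
      (N / Q + 1 : ℕ) * (2 / δ * (1 + Real.log Q)) := by
  have hmaps : ∀ k ∈ (Finset.range N).filter fun k => ¬‖z k‖ < δ,
      k / Q ∈ Finset.range (N / Q + 1) := fun k hk => Finset.mem_range_succ_iff.2 <|
    Nat.div_le_div_right (Finset.mem_range.1 (Finset.mem_filter.1 hk).1).le
  rw [← Finset.sum_fiberwise_of_maps_to hmaps]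
  refine (Finset.sum_le_card_nsmul _ _ (2 / δ * (1 + Real.log Q)) fun b _ => ?_).trans_eq (by simp)
  set fiber := {k ∈ (Finset.range N).filter fun k => ¬‖z k‖ < δ | k / Q = b}
  have hfiber : fiber ⊆ Finset.Ico (b * Q) (b * Q + Q) := fun k hk => by
    obtain ⟨-, rfl⟩ := Finset.mem_filter.1 hk
    exact Finset.mem_Ico.2 ⟨Nat.div_mul_le_self k Q, Nat.lt_div_mul_add hQ⟩
  have hcard : fiber.card ≤ Q := (Finset.card_le_card hfiber).trans_eq (by simp)
  refine sum_one_div_norm_le_of_pairwise hδ (fun k hk => ?_) ((hz b).mono fun k hk => ?_) hcard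
  · exact not_lt.1 (Finset.mem_filter.1 (Finset.mem_filter.1 hk).1).2
  · simpa using hfiber hk

theorem sum_range_emod_of_isCoprime {M : Type*} [AddCommMonoid M] (f : ℕ → M) {a : ℤ}
    (ha : IsCoprime a Q) (c : ℤ) :
    ∑ k ∈ Finset.range Q, f ((c + k * a) % Q).toNat = ∑ m ∈ Finset.range Q, f m := by
  have hmaps : Set.MapsTo (fun k : ℕ => ((c + k * a) % Q).toNat) (Finset.range Q)
      (Finset.range Q) := fun k hk => by
    have hQ : (0 : ℤ) < Q := by exact_mod_cast (Nat.zero_le k).trans_lt (Finset.mem_range.1 hk)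
    have := Int.emod_lt_of_pos (c + k * a) hQ
    simp only [Finset.coe_range, Set.mem_Iio]
    lia
  have hinj : Set.InjOn (fun k : ℕ => ((c + k * a) % Q).toNat) (Finset.range Q) := by
    intro j hj k hk hjk
    have hj := Finset.mem_range.1 hj
    have hk := Finset.mem_range.1 hk
    have hQ : (Q : ℤ) ≠ 0 := by lia
    have hmod : (c + j * a) % Q = (c + k * a) % Q := by
      have := Int.emod_nonneg (c + j * a) hQ
      have := Int.emod_nonneg (c + k * a) hQ
      simp only at hjk
      lia
    have hdvd : (Q : ℤ) ∣ (j - k) * a := by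
      simpa only [add_sub_add_left_eq_sub, ← sub_mul] using Int.ModEq.dvd hmod.symm
    have := Int.eq_zero_of_abs_lt_dvd (ha.symm.dvd_of_dvd_mul_right hdvd)
      (abs_lt.2 ⟨by lia, by lia⟩)
    lia
  exact Finset.sum_nbij _ hmaps hinj
    (Finset.surjOn_of_injOn_of_card_le _ hmaps hinj le_rfl) fun _ _ => rfl

end Blocks

section LogBounds

theorem log_add_two_div_two_le_sum (Q : ℕ) :
    Real.log ((Q + 2) / 2) ≤ ∑ m ∈ Finset.range Q, 1 / ((m : ℝ) + 2) := by
  induction Q with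
  | zero => simp
  | succ Q ih =>
    have hfactor : (((Q + 1 : ℕ) : ℝ) + 2) / 2 = (Q + 2) / 2 * (1 + 1 / (Q + 2)) := by
      push_cast
      field_simp
      ring
    have hpos : (0 : ℝ) < 1 + 1 / (Q + 2) := by positivity
    rw [Finset.sum_range_succ, hfactor, Real.log_mul (by positivity) hpos.ne']
    linarith [Real.log_le_sub_one_of_pos hpos]

theorem log_div_two_le_log_add_two_div_two {t : ℝ} (ht : 0 < t) :
    Real.log t / 2 ≤ Real.log ((t + 2) / 2) := by
  have h : Real.log t ≤ Real.log (((t + 2) / 2) ^ 2) := Real.log_le_log ht (by nlinarith)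
  rw [Real.log_pow] at h
  push_cast at h
  linarith

end LogBounds

/-- Up to an error of at most `1 / Q`, the point `r + k α` lies at distance `m / Q` to the right
of `0`, where `m` is the residue of `⌊Q r⌋ + k a` modulo `Q`. -/
theorem norm_coe_add_nsmul_le {α r : ℝ} {a : ℤ} {Q k : ℕ} (hQ : 0 < Q) (hk : k ≤ Q)
    (hα : |Q * α - a| ≤ 1 / Q) :
    ‖(r : UnitAddCircle) + k • (α : UnitAddCircle)‖ ≤
      ((((⌊Q * r⌋ + k * a) % Q).toNat : ℝ) + 2) / Q := by
  have : (0 : ℝ) < Q := by exact_mod_cast hQ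
  have hmod_nonneg := Int.emod_nonneg (⌊Q * r⌋ + k * a) (b := Q) (by lia)
  set m := ((⌊Q * r⌋ + k * a) % Q).toNat
  have hm : Q * ((⌊Q * r⌋ + k * a) / Q) + (m : ℤ) = ⌊Q * r⌋ + k * a := by
    rw [Int.toNat_of_nonneg hmod_nonneg, Int.mul_ediv_add_emod]
  have hm' : Q * (((⌊Q * r⌋ + k * a) / Q : ℤ) : ℝ) + m = ⌊Q * r⌋ + k * a := by exact_mod_cast hm
  have hrep : (r : UnitAddCircle) + k • (α : UnitAddCircle) =
      (((m + Int.fract (Q * r)) + k * (Q * α - a)) / Q : ℝ) := by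
    rw [← AddCircle.coe_nsmul, ← AddCircle.coe_add, ← sub_eq_zero, ← AddCircle.coe_sub,
      AddCircle.coe_eq_zero_iff]
    refine ⟨(⌊Q * r⌋ + k * a) / Q, ?_⟩
    have := Int.floor_add_fract (Q * r)
    simp only [zsmul_eq_mul, nsmul_eq_mul]
    field_simp
    linarith
  have herror : k * |Q * α - a| ≤ 1 := calc
    k * |Q * α - a| ≤ Q * (1 / Q) := by gcongr
    _ = 1 := by field_simp
  rw [hrep]
  refine QuotientAddGroup.norm_mk_le_norm.trans ?_
  rw [Real.norm_eq_abs, abs_div, Nat.abs_cast]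
  gcongr
  refine (abs_add_le _ _).trans ?_
  rw [abs_mul, Nat.abs_cast, abs_of_nonneg (by positivity)]
  linarith [Int.fract_lt_one (Q * r)]

theorem mul_log_le_birkhoffSum_of_isCoprime {α : ℝ} {a : ℤ} {Q : ℕ} (ha : IsCoprime a Q)
    (hα : |Q * α - a| ≤ 1 / Q) {x : UnitAddCircle}
    (hx : ∀ k : ℕ, x + k • (α : UnitAddCircle) ≠ 0) :
    Q * (Real.log Q / 2) ≤ birkhoffSum (torusRotation α) phi Q x := by
  rcases Q.eq_zero_or_pos with rfl | hQ
  · simp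
  obtain ⟨r, -, rfl⟩ := exists_mem_Ico_coe_eq x
  rw [birkhoffSum_torusRotation]
  calc Q * (Real.log Q / 2) ≤ Q * ∑ m ∈ Finset.range Q, 1 / ((m : ℝ) + 2) := by
        gcongr
        exact (log_div_two_le_log_add_two_div_two (by exact_mod_cast hQ)).trans
          (log_add_two_div_two_le_sum Q)
    _ = ∑ k ∈ Finset.range Q, 1 / (((((⌊Q * r⌋ + k * a) % Q).toNat : ℝ) + 2) / Q) := by
        rw [sum_range_emod_of_isCoprime (fun m => 1 / (((m : ℝ) + 2) / Q)) ha, Finset.mul_sum]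
        simp only [one_div_div, mul_one_div]
    _ ≤ ∑ k ∈ Finset.range Q, phi ((r : UnitAddCircle) + k • (α : UnitAddCircle)) := by
        refine Finset.sum_le_sum fun k hk => (one_div_norm_le_phi (hx k)).trans' ?_
        exact one_div_le_one_div_of_le (norm_pos_iff.2 (hx k))
          (norm_coe_add_nsmul_le hQ (Finset.mem_range.1 hk).le hα)

namespace IsConvergentSeq

variable {α : ℝ} {p : ℕ → ℤ} {q : ℕ → ℕ}

theorem pairwise_le_norm_sub (H : IsConvergentSeq α p q) (n P : ℕ) (x : UnitAddCircle) :
    (Set.Ico P (P + q (n + 1))).Pairwise fun j k =>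
      1 / (2 * q (n + 1)) ≤ ‖x + j • (α : UnitAddCircle) - (x + k • (α : UnitAddCircle))‖ := by
  intro j hj k hk hne
  wlog h : k < j generalizing j k
  · rw [norm_sub_rev]
    exact this hk hj hne.symm (hne.lt_or_gt.resolve_right h)
  obtain ⟨d, rfl⟩ := Nat.exists_eq_add_of_lt h
  have hd : d + 1 < q (n + 1) := by
    have := hj.2
    have := hk.1
    lia
  rw [add_assoc k, add_nsmul, ← add_assoc, add_sub_right_comm, sub_self, zero_add]
  exact H.one_div_two_mul_le_norm n d.succ_pos hd

theorem mul_log_le_birkhoffSum (H : IsConvergentSeq α p q) (n : ℕ) {N : ℕ} (hN : q n ≤ N)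
    {x : UnitAddCircle} (hx : ∀ k : ℕ, x + k • (α : UnitAddCircle) ≠ 0) :
    N * Real.log (q n) / 4 ≤ birkhoffSum (torusRotation α) phi N x := by
  have hα : |q n * α - p n| ≤ 1 / q n := (H.abs_sub_le n).trans <|
    one_div_le_one_div_of_le (H.cast_pos n) (by exact_mod_cast H.le_succ n)
  have hblock (m : ℕ) : q n * (Real.log (q n) / 2) ≤
      birkhoffSum (torusRotation α) phi (q n) ((torusRotation α)^[m] x) := by
    refine mul_log_le_birkhoffSum_of_isCoprime (H.isCoprime n) hα fun k => ?_
    rw [torusRotation_iterate, add_assoc, ← add_nsmul]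
    exact hx _
  have hblocks : (N : ℝ) ≤ 2 * ((N / q n : ℕ) * q n) := by
    have := Nat.lt_div_mul_add (a := N) (H.pos n)
    have := Nat.le_mul_of_pos_left (q n) (Nat.div_pos hN (H.pos n))
    exact_mod_cast (by lia : N ≤ 2 * (N / q n * q n))
  have := Real.log_nonneg (H.one_le_cast n)
  calc N * Real.log (q n) / 4 ≤ 2 * ((N / q n : ℕ) * q n) * Real.log (q n) / 4 := by gcongr
    _ = (N / q n : ℕ) * (q n * (Real.log (q n) / 2)) := by ring
    _ ≤ birkhoffSum (torusRotation α) phi (N / q n * q n) x := mul_le_birkhoffSum_mul hblock _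
    _ ≤ birkhoffSum (torusRotation α) phi N x :=
        monotone_birkhoffSum_phi _ _ (Nat.div_mul_le_self _ _)

theorem one_div_four_mul_le_norm (H : IsConvergentSeq α p q) (n : ℕ) {N k : ℕ}
    (hN : N < q (n + 1)) (hk : k < N) {x : UnitAddCircle}
    (hx : ‖x + N • (α : UnitAddCircle)‖ ≤ 1 / (4 * q (n + 1))) :
    1 / (4 * q (n + 1)) ≤ ‖x + k • (α : UnitAddCircle)‖ := by
  have hsep := H.pairwise_le_norm_sub n 0 x ⟨N.zero_le, by lia⟩ ⟨k.zero_le, by lia⟩ hk.ne'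
  have hhalf : 1 / (2 * q (n + 1) : ℝ) = 2 * (1 / (4 * q (n + 1))) := by ring
  linarith [norm_sub_le (x + N • (α : UnitAddCircle)) (x + k • (α : UnitAddCircle))]

theorem sum_near_le (H : IsConvergentSeq α p q) (n : ℕ) {N : ℕ}
    (hN : N < q (n + 2)) {x : UnitAddCircle}
    (hx : ‖x + N • (α : UnitAddCircle)‖ ≤ 1 / (4 * q (n + 2))) :
    ∑ k ∈ Finset.range N with ‖x + k • (α : UnitAddCircle)‖ < 1 / (4 * q (n + 1)),
      1 / ‖x + k • (α : UnitAddCircle)‖ ≤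
        8 * q (n + 2) * (1 + Real.log (N / q (n + 1) + 1)) := by
  have hq := H.cast_pos (n + 2)
  have hcard := card_filter_norm_lt_le_of_pairwise (δ := 1 / (4 * q (n + 1))) (H.pos (n + 1))
    (fun b => (H.pairwise_le_norm_sub n (b * q (n + 1)) x).mono' fun j k h =>
      (by ring : 2 * (1 / (4 * q (n + 1) : ℝ)) = 1 / (2 * q (n + 1))).trans_le h) N
  have hsep := (H.pairwise_le_norm_sub (n + 1) 0 x).mono (t := (Finset.range N : Set ℕ))
    fun k hk => Set.mem_Ico.2 ⟨k.zero_le, by simpa using (Finset.mem_range.1 hk).trans hN⟩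
  have hsum := sum_one_div_norm_le_of_pairwise (δ := 1 / (4 * q (n + 2))) (by positivity)
    (fun k hk => H.one_div_four_mul_le_norm (n + 1) hN
      (Finset.mem_range.1 (Finset.mem_filter.1 hk).1) hx)
    ((hsep.mono (Finset.coe_subset.2 (Finset.filter_subset _ _))).mono'
      fun j k h => h.trans' (by gcongr; norm_num)) hcard
  refine hsum.trans ?_
  rw [show 2 / (1 / (4 * q (n + 2) : ℝ)) = 8 * q (n + 2) by field_simp; norm_num]
  push_cast
  gcongr
  exact Nat.cast_div_le

theorem sum_far_le (H : IsConvergentSeq α p q) (n : ℕ) {N : ℕ} (hN : q (n + 1) ≤ N)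
    (x : UnitAddCircle) :
    ∑ k ∈ Finset.range N with ¬‖x + k • (α : UnitAddCircle)‖ < 1 / (4 * q (n + 1)),
      1 / ‖x + k • (α : UnitAddCircle)‖ ≤ 16 * N * (1 + Real.log (q (n + 1))) := by
  have hq := H.cast_pos (n + 1)
  have hlog : 0 ≤ Real.log (q (n + 1)) := Real.log_nonneg (H.one_le_cast _)
  have hblocks : ((N / q (n + 1) + 1 : ℕ) : ℝ) * q (n + 1) ≤ 2 * N := by
    have := Nat.div_mul_le_self N (q (n + 1))
    exact_mod_cast (by lia : (N / q (n + 1) + 1) * q (n + 1) ≤ 2 * N)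
  refine (sum_filter_one_div_norm_le_of_pairwise (H.pos _) (by positivity) (fun b =>
    (H.pairwise_le_norm_sub n (b * q (n + 1)) x).mono' fun j k h =>
      h.trans' (by gcongr; norm_num)) N).trans ?_
  rw [show 2 / (1 / (4 * q (n + 1) : ℝ)) = 8 * q (n + 1) by field_simp; norm_num]
  nlinarith [mul_le_mul_of_nonneg_right hblocks hlog]

theorem birkhoffSum_le (H : IsConvergentSeq α p q) (n : ℕ) {N : ℕ} (hN : q (n + 1) ≤ N)
    (hN' : N < q (n + 2)) {x : UnitAddCircle}
    (hx : ‖x + N • (α : UnitAddCircle)‖ ≤ 1 / (4 * q (n + 2))) :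
    birkhoffSum (torusRotation α) phi N x ≤ 32 * N * (1 + Real.log (q (n + 1))) +
      16 * q (n + 2) * (1 + Real.log (N / q (n + 1) + 1)) := by
  have hq := H.cast_pos (n + 2)
  have hpos : ∀ k ∈ Finset.range N, 0 < ‖x + k • (α : UnitAddCircle)‖ := fun k hk =>
    (H.one_div_four_mul_le_norm (n + 1) hN' (Finset.mem_range.1 hk) hx).trans_lt' (by positivity)
  have hphi : birkhoffSum (torusRotation α) phi N x ≤
      2 * ∑ k ∈ Finset.range N, 1 / ‖x + k • (α : UnitAddCircle)‖ := by
    rw [birkhoffSum_torusRotation, Finset.mul_sum]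
    refine Finset.sum_le_sum fun k hk => ?_
    rw [mul_one_div]
    exact phi_le_two_div_norm (norm_pos_iff.1 (hpos k hk))
  rw [← Finset.sum_filter_add_sum_filter_not _
    fun k => ‖x + k • (α : UnitAddCircle)‖ < 1 / (4 * q (n + 1))] at hphi
  linarith [H.sum_near_le n hN' hx, H.sum_far_le n hN x]

end IsConvergentSeq

section LogSums

theorem log_succ_div_eq_add {A B : ℕ} (hA : 0 < A) (hB : 0 < B) :
    Real.log ((B + 1 : ℕ) / A) = Real.log (B / A) + Real.log ((B + 1 : ℕ) / B) := by
  rw [← Real.log_mul (by positivity) (by positivity)]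
  congr 1
  field_simp

theorem sum_Ico_one_div_le {A B : ℕ} (hA : 0 < A) (hAB : A ≤ B) :
    ∑ N ∈ Finset.Ico A B, (1 : ℝ) / N ≤ 1 / A - 1 / B + Real.log (B / A) := by
  induction B, hAB using Nat.le_induction with
  | base => simp [hA.ne']
  | succ B hB ih =>
    have hB0 : 0 < B := hA.trans_le hB
    have hlog := Real.one_sub_inv_le_log_of_pos (x := (B + 1 : ℕ) / B) (by positivity)
    have hinv : 1 - (((B + 1 : ℕ) : ℝ) / B)⁻¹ = 1 / (B + 1 : ℕ) := by
      push_cast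
      field_simp
      ring
    rw [Finset.sum_Ico_succ_top hB, log_succ_div_eq_add hA hB0]
    linarith

theorem log_div_le_sum_Ico_one_div {A B : ℕ} (hA : 0 < A) (hAB : A ≤ B) :
    Real.log (B / A) ≤ ∑ N ∈ Finset.Ico A B, (1 : ℝ) / N := by
  induction B, hAB using Nat.le_induction with
  | base => simp [hA.ne']
  | succ B hB ih =>
    have hB0 : 0 < B := hA.trans_le hB
    have hlog := Real.log_le_sub_one_of_pos (x := (B + 1 : ℕ) / B) (by positivity)
    have hsub : ((B + 1 : ℕ) : ℝ) / B - 1 = 1 / B := by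
      push_cast
      field_simp
      ring
    rw [Finset.sum_Ico_succ_top hB, log_succ_div_eq_add hA hB0]
    linarith

theorem one_third_le_log_add_two_div_two {t : ℝ} (ht : 1 ≤ t) :
    1 / 3 ≤ Real.log ((t + 2) / 2) := by
  have hthree := Real.one_sub_inv_le_log_of_pos (x := 3 / 2) (by norm_num)
  have hle : Real.log (3 / 2) ≤ Real.log ((t + 2) / 2) :=
    Real.log_le_log (by norm_num) (by linarith)
  norm_num at hthree
  linarith

theorem one_div_log_add_two_div_two_le {X t : ℝ} (hX : 1 < X) (ht : 1 ≤ t) :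
    1 / Real.log ((t + 2) / 2) ≤ (if t ≤ √X then 3 else 0) + 4 / Real.log X := by
  have hlogX : 0 < Real.log X := Real.log_pos hX
  have hthird := one_third_le_log_add_two_div_two ht
  split_ifs with h
  · have : 1 / Real.log ((t + 2) / 2) ≤ 3 := by
      rw [div_le_iff₀ (by linarith)]
      linarith
    linarith [div_pos four_pos hlogX]
  · have hhalf := log_div_two_le_log_add_two_div_two (zero_lt_one.trans_le ht)
    have hsqrt : Real.log √X ≤ Real.log t :=
      Real.log_le_log (Real.sqrt_pos.2 (by linarith)) (not_le.1 h).le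
    rw [Real.log_sqrt (by linarith)] at hsqrt
    rw [zero_add, div_le_div_iff₀ (by linarith) hlogX]
    linarith

theorem sum_one_div_log_le {X : ℝ} (hX : 1 < X) :
    ∑ b ∈ Finset.Icc 1 ⌊X⌋₊, 1 / Real.log (((b : ℝ) + 2) / 2) ≤ 3 * √X + 4 * (X / Real.log X) := by
  have hlogX : 0 < Real.log X := Real.log_pos hX
  have hcard : (((Finset.Icc 1 ⌊X⌋₊).filter fun b : ℕ => (b : ℝ) ≤ √X).card : ℝ) ≤ √X := by
    refine le_trans ?_ (Nat.floor_le (Real.sqrt_nonneg X))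
    have hsub : ((Finset.Icc 1 ⌊X⌋₊).filter fun b : ℕ => (b : ℝ) ≤ √X) ⊆ Finset.Icc 1 ⌊√X⌋₊ :=
      fun b hb => Finset.mem_Icc.2 ⟨(Finset.mem_Icc.1 (Finset.mem_filter.1 hb).1).1,
        Nat.le_floor (Finset.mem_filter.1 hb).2⟩
    exact_mod_cast (Finset.card_le_card hsub).trans_eq (by simp)
  have hfloor : (⌊X⌋₊ : ℝ) * (4 / Real.log X) ≤ X * (4 / Real.log X) := by
    gcongr
    exact Nat.floor_le (by linarith)
  calc ∑ b ∈ Finset.Icc 1 ⌊X⌋₊, 1 / Real.log (((b : ℝ) + 2) / 2)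
      ≤ ∑ b ∈ Finset.Icc 1 ⌊X⌋₊, ((if (b : ℝ) ≤ √X then 3 else 0) + 4 / Real.log X) :=
        Finset.sum_le_sum fun b hb => one_div_log_add_two_div_two_le hX
          (by exact_mod_cast (Finset.mem_Icc.1 hb).1)
    _ = ((Finset.Icc 1 ⌊X⌋₊).filter fun b : ℕ => (b : ℝ) ≤ √X).card * 3 +
        ⌊X⌋₊ * (4 / Real.log X) := by
        simp [Finset.sum_add_distrib, ← Finset.sum_filter]
    _ ≤ √X * 3 + X * (4 / Real.log X) := by gcongr
    _ = 3 * √X + 4 * (X / Real.log X) := by ring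

theorem sum_one_div_log_le_mul {Z : ℝ} (hZ : 2 ≤ Z) :
    ∑ b ∈ Finset.Icc 1 ⌊Z * (1 + Real.log Z)⌋₊, 1 / Real.log (((b : ℝ) + 2) / 2) ≤ 11 * Z := by
  have hlogZ : 0.6931471803 < Real.log Z :=
    Real.log_two_gt_d9.trans_le (Real.log_le_log (by norm_num) hZ)
  have hlogZ_le : Real.log Z ≤ Z - 1 := Real.log_le_sub_one_of_pos (by linarith)
  set X := Z * (1 + Real.log Z) with hX
  have hX3 : 3.3 ≤ X := by nlinarith
  have hsqrt : √X ≤ Z := by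
    rw [Real.sqrt_le_left (by linarith)]
    nlinarith
  have hlogX_one : 1 ≤ Real.log X := by
    rw [Real.le_log_iff_exp_le (by linarith)]
    linarith [Real.exp_one_lt_d9]
  have hlogX : Real.log Z ≤ Real.log X := Real.log_le_log (by linarith) (by nlinarith)
  have hdiv : X / Real.log X ≤ 2 * Z := by
    rw [div_le_iff₀ (by linarith), hX]
    nlinarith
  linarith [sum_one_div_log_le (by linarith : 1 < X)]

theorem sum_comp_div_le {F T : Finset ℕ} {Q : ℕ} {g : ℕ → ℝ} (hQ : 0 < Q)
    (hmaps : ∀ N ∈ F, N / Q ∈ T) (hg : ∀ b ∈ T, 0 ≤ g b) :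
    ∑ N ∈ F, g (N / Q) ≤ Q * ∑ b ∈ T, g b := by
  rw [← Finset.sum_fiberwise_of_maps_to hmaps, Finset.mul_sum]
  refine Finset.sum_le_sum fun b hb => ?_
  have hfiber : F.filter (fun N => N / Q = b) ⊆ Finset.Ico (b * Q) (b * Q + Q) := fun N hN => by
    obtain ⟨-, rfl⟩ := Finset.mem_filter.1 hN
    exact Finset.mem_Ico.2 ⟨Nat.div_mul_le_self N Q, Nat.lt_div_mul_add hQ⟩
  have hcard : (F.filter fun N => N / Q = b).card ≤ Q :=
    (Finset.card_le_card hfiber).trans_eq (by simp)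
  calc ∑ N ∈ F with N / Q = b, g (N / Q) = ∑ N ∈ F with N / Q = b, g b :=
        Finset.sum_congr rfl fun N hN => by rw [(Finset.mem_filter.1 hN).2]
    _ = (F.filter fun N => N / Q = b).card * g b := by rw [Finset.sum_const, nsmul_eq_mul]
    _ ≤ Q * g b := by
        gcongr
        exact hg b hb

theorem sum_filter_one_div_log_le {Q Q' : ℕ} {Z : ℝ} (hQ : 0 < Q) (hZ : 2 ≤ Z) :
    ∑ N ∈ (Finset.Ico Q Q').filter (fun N : ℕ => (N : ℝ) < Z * (1 + Real.log Z) * Q),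
      1 / Real.log (((N / Q : ℕ) + 2) / 2) ≤ Q * (11 * Z) := by
  refine (sum_comp_div_le (T := Finset.Icc 1 ⌊Z * (1 + Real.log Z)⌋₊)
    (g := fun b => 1 / Real.log (((b : ℝ) + 2) / 2)) hQ (fun N hN => ?_) fun b hb => ?_).trans ?_
  · obtain ⟨hN, hlt⟩ := Finset.mem_filter.1 hN
    refine Finset.mem_Icc.2 ⟨Nat.div_pos (Finset.mem_Ico.1 hN).1 hQ, Nat.le_floor ?_⟩
    refine Nat.cast_div_le.trans ?_
    rw [div_le_iff₀ (by exact_mod_cast hQ)]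
    exact hlt.le
  · have hb1 : (1 : ℝ) ≤ b := by exact_mod_cast (Finset.mem_Icc.1 hb).1
    exact one_div_nonneg.2 (Real.log_nonneg (by linarith))
  · gcongr
    exact sum_one_div_log_le_mul hZ

theorem sum_filter_one_div_le {Q Q' : ℕ} {L Z : ℝ} (hQ : 0 < Q) (hL : 0 < L) (hZ : 2 ≤ Z)
    (hZL : Z * Q * L = Q') :
    ∑ N ∈ (Finset.Ico Q Q').filter (fun N : ℕ => Z * (1 + Real.log Z) * Q ≤ N), (1 : ℝ) / N ≤
      1 / Q + max 1 (Real.log L - Real.log (Real.log Z)) := by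
  have hQ0 : (0 : ℝ) < Q := by exact_mod_cast hQ
  have hlogZ : 0 < Real.log Z := Real.log_pos (by linarith)
  set A := ⌈Z * (1 + Real.log Z) * Q⌉₊
  have hA_le : Z * (1 + Real.log Z) * Q ≤ A := Nat.le_ceil _
  have hQA : (Q : ℝ) ≤ A := by nlinarith [mul_pos (by linarith : 0 < Z) hlogZ]
  have hsub : (Finset.Ico Q Q').filter (fun N : ℕ => Z * (1 + Real.log Z) * Q ≤ N) ⊆
      Finset.Ico A Q' := fun N hN => Finset.mem_Ico.2
    ⟨Nat.ceil_le.2 (Finset.mem_filter.1 hN).2, (Finset.mem_Ico.1 (Finset.mem_filter.1 hN).1).2⟩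
  refine (Finset.sum_le_sum_of_subset_of_nonneg hsub fun _ _ _ => by positivity).trans ?_
  rcases le_or_gt A Q' with h | h
  · have hA0 : 0 < A := hQ.trans_le (by exact_mod_cast hQA)
    have hQ'0 : 0 < Q' := hA0.trans_le h
    have hratio : (Q' : ℝ) / A ≤ L / Real.log Z := by
      rw [div_le_div_iff₀ (by positivity) hlogZ, ← hZL]
      nlinarith [mul_le_mul_of_nonneg_left hA_le hL.le,
        mul_pos (mul_pos (by linarith : 0 < Z) hQ0) hL]
    have hlog : Real.log (Q' / A) ≤ Real.log L - Real.log (Real.log Z) :=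
      (Real.log_le_log (by positivity) hratio).trans_eq (Real.log_div hL.ne' hlogZ.ne')
    have : (0 : ℝ) ≤ 1 / Q' := by positivity
    linarith [sum_Ico_one_div_le hA0 h, one_div_le_one_div_of_le hQ0 hQA,
      le_max_right 1 (Real.log L - Real.log (Real.log Z))]
  · rw [Finset.Ico_eq_empty (by lia), Finset.sum_empty]
    positivity

theorem sum_filter_lt_mul_one_div_le {Q Q' b : ℕ} (hQ : 0 < Q) (hb : 0 < b) :
    ∑ N ∈ (Finset.Ico Q Q').filter (fun N : ℕ => (N : ℝ) < b * Q), (1 : ℝ) / N ≤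
      1 / Q + Real.log b := by
  have hsub : (Finset.Ico Q Q').filter (fun N : ℕ => (N : ℝ) < b * Q) ⊆ Finset.Ico Q (b * Q) :=
    fun N hN => Finset.mem_Ico.2 ⟨(Finset.mem_Ico.1 (Finset.mem_filter.1 hN).1).1,
      by exact_mod_cast (Finset.mem_filter.1 hN).2⟩
  have hsum := sum_Ico_one_div_le hQ (Nat.le_mul_of_pos_left Q hb)
  have : (0 : ℝ) ≤ 1 / (b * Q : ℕ) := by positivity
  rw [show ((b * Q : ℕ) : ℝ) / Q = b by push_cast; field_simp] at hsum
  linarith [Finset.sum_le_sum_of_subset_of_nonneg (f := fun N : ℕ => (1 : ℝ) / N) hsub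
    fun _ _ _ => by positivity]

end LogSums

/-- The term `W_n` as a function of two consecutive denominators `Q = q_n` and `Q' = q_{n+1}`. -/
noncomputable def growthWeight (Q Q' : ℝ) : ℝ :=
  if Q' < 2 * Q * Real.log Q then (Real.log Q' - Real.log Q) / Real.log Q
  else max 1 (Real.log (Real.log Q) - Real.log (Real.log (Q' / (Q * Real.log Q)))) / Real.log Q

/-- The set of points `x` for which the term of index `N` of the sequence of values of `phi` along
the orbit of `x` exceeds `ε` times the sum of the previous terms. -/
def exceedanceSet (α ε : ℝ) (N : ℕ) : Set UnitAddCircle :=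
  {x | ε * birkhoffSum (torusRotation α) phi N x < phi (x + N • (α : UnitAddCircle))}

section Exceedance

open MeasureTheory

theorem measureReal_closedBall_le (z : UnitAddCircle) {r : ℝ} (hr : 0 ≤ r) :
    volume.real (Metric.closedBall z r) ≤ 2 * r := by
  rw [Measure.real, AddCircle.volume_closedBall]
  exact ENNReal.toReal_le_of_le_ofReal (by positivity)
    (ENNReal.ofReal_le_ofReal (min_le_right _ _))

theorem ae_forall_add_nsmul_ne_zero (a : UnitAddCircle) :
    ∀ᵐ x : UnitAddCircle, ∀ k : ℕ, x + k • a ≠ 0 := by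
  refine ae_all_iff.2 fun k => ae_iff.2 ?_
  have hset : {x : UnitAddCircle | ¬x + k • a ≠ 0} = Metric.closedBall (-(k • a)) 0 := by
    ext x
    simp [eq_neg_iff_add_eq_zero]
  rw [hset, AddCircle.volume_closedBall]
  simp

theorem norm_mul_birkhoffSum_lt_of_mem_exceedanceSet {α ε : ℝ} {N : ℕ} {x : UnitAddCircle}
    (hε : 0 < ε) (hx : x + N • (α : UnitAddCircle) ≠ 0) (h : x ∈ exceedanceSet α ε N) :
    ‖x + N • (α : UnitAddCircle)‖ * birkhoffSum (torusRotation α) phi N x < 2 / ε := by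
  have hlt := h.out.trans_le (phi_le_two_div_norm hx)
  rw [lt_div_iff₀ (norm_pos_iff.2 hx)] at hlt
  rw [lt_div_iff₀ hε]
  linarith

theorem measureReal_exceedanceSet_le {α ε r : ℝ} {N : ℕ} (hr : 0 ≤ r)
    (h : ∀ x ∈ exceedanceSet α ε N, (∀ k : ℕ, x + k • (α : UnitAddCircle) ≠ 0) →
      ‖x + N • (α : UnitAddCircle)‖ ≤ r) :
    volume.real (exceedanceSet α ε N) ≤ 2 * r := by
  have hsub : ∀ᵐ x : UnitAddCircle, x ∈ exceedanceSet α ε N →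
      x ∈ Metric.closedBall (-(N • (α : UnitAddCircle))) r := by
    filter_upwards [ae_forall_add_nsmul_ne_zero (α : UnitAddCircle)] with x hx hmem
    rw [Metric.mem_closedBall, dist_eq_norm, sub_neg_eq_add]
    exact h x hmem hx
  exact (ENNReal.toReal_mono (measure_ne_top _ _) (measure_mono_ae hsub)).trans
    (measureReal_closedBall_le _ hr)

namespace IsConvergentSeq

variable {α : ℝ} {p : ℕ → ℤ} {q : ℕ → ℕ}

theorem measureReal_exceedanceSet_le_one_div (H : IsConvergentSeq α p q) {ε : ℝ} (hε : 0 < ε)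
    {n N : ℕ} (hn : 1 < q n) (hN : q n ≤ N) :
    volume.real (exceedanceSet α ε N) ≤ 16 / (ε * Real.log (q n)) * (1 / N) := by
  have hlog : 0 < Real.log (q n) := Real.log_pos (by exact_mod_cast hn)
  have hN0 : (0 : ℝ) < N := by exact_mod_cast (H.pos n).trans_le hN
  refine (measureReal_exceedanceSet_le (r := 8 / (ε * Real.log (q n) * N)) (by positivity)
    fun x hmem hx => ?_).trans_eq (by field_simp; norm_num)
  have hlt := norm_mul_birkhoffSum_lt_of_mem_exceedanceSet hε (hx N) hmem
  have hle := mul_le_mul_of_nonneg_left (H.mul_log_le_birkhoffSum n hN hx)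
    (norm_nonneg (x + N • (α : UnitAddCircle)))
  rw [lt_div_iff₀ hε] at hlt
  rw [le_div_iff₀ (by positivity)]
  linarith [mul_le_mul_of_nonneg_right hle hε.le]

theorem norm_nsmul_mul_le (H : IsConvergentSeq α p q) (n j : ℕ) :
    ‖(j * q n) • (α : UnitAddCircle)‖ ≤ j / q (n + 1) := by
  have hnorm : ‖q n • (α : UnitAddCircle)‖ ≤ 1 / q (n + 1) := by
    rw [← AddCircle.coe_nsmul, nsmul_eq_mul, UnitAddCircle.norm_eq]
    exact (round_le _ (p n)).trans (H.abs_sub_le n)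
  rw [mul_nsmul', ← mul_one_div]
  exact norm_nsmul_le.trans (by gcongr)

/-- The orbit returns near `x + N α` at the times `N - q_n, N - 2 q_n, …`, and the distances
to `0` at these times grow at most linearly. -/
theorem log_div_max_le_birkhoffSum (H : IsConvergentSeq α p q) (n N : ℕ) {x : UnitAddCircle}
    (hx : ∀ k : ℕ, x + k • (α : UnitAddCircle) ≠ 0) :
    Real.log (((N / q n : ℕ) + 2) / 2) / max ‖x + N • (α : UnitAddCircle)‖ (1 / q (n + 1)) ≤
      birkhoffSum (torusRotation α) phi N x := by
  set M := max ‖x + N • (α : UnitAddCircle)‖ (1 / q (n + 1)) with hM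
  have hM0 : 0 < M := (norm_pos_iff.2 (hx N)).trans_le (le_max_left _ _)
  have htime {j : ℕ} (hj : j ∈ Finset.range (N / q n)) : (j + 1) * q n ≤ N :=
    (Nat.mul_le_mul_right _ (Finset.mem_range.1 hj)).trans (Nat.div_mul_le_self _ _)
  have hterm {j : ℕ} (hj : j ∈ Finset.range (N / q n)) :
      1 / (j + 2 : ℝ) / M ≤ phi (x + (N - (j + 1) * q n) • (α : UnitAddCircle)) := by
    rw [div_div]
    refine (one_div_norm_le_phi (hx _)).trans' (one_div_le_one_div_of_le
      (norm_pos_iff.2 (hx _)) ?_)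
    have hreturn := H.norm_nsmul_mul_le n (j + 1)
    rw [sub_nsmul _ (htime hj), ← sub_eq_add_neg, ← add_sub_assoc]
    refine (norm_sub_le_of_le (le_max_left _ (1 / (q (n + 1) : ℝ))) hreturn).trans ?_
    rw [← hM, ← mul_one_div]
    push_cast
    nlinarith [le_max_right ‖x + N • (α : UnitAddCircle)‖ (1 / q (n + 1))]
  have hinj : Set.InjOn (fun j => N - (j + 1) * q n) (Finset.range (N / q n) : Set ℕ) := by
    intro i hi j hj hij
    have := htime (Finset.mem_coe.1 hi)
    have := htime (Finset.mem_coe.1 hj)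
    have : (i + 1) * q n = (j + 1) * q n := by simp only at hij; lia
    simpa using Nat.eq_of_mul_eq_mul_right (H.pos n) this
  calc Real.log (((N / q n : ℕ) + 2) / 2) / M
      ≤ ∑ j ∈ Finset.range (N / q n), 1 / (j + 2 : ℝ) / M := by
        rw [← Finset.sum_div]
        gcongr
        exact log_add_two_div_two_le_sum _
    _ ≤ ∑ j ∈ Finset.range (N / q n), phi (x + (N - (j + 1) * q n) • (α : UnitAddCircle)) :=
        Finset.sum_le_sum fun j hj => hterm hj
    _ = ∑ k ∈ (Finset.range (N / q n)).image fun j => N - (j + 1) * q n,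
          phi (x + k • (α : UnitAddCircle)) := by
        rw [Finset.sum_image hinj]
    _ ≤ birkhoffSum (torusRotation α) phi N x := by
        rw [birkhoffSum_torusRotation]
        refine Finset.sum_le_sum_of_subset_of_nonneg (Finset.image_subset_iff.2 fun j hj => ?_)
          fun _ _ _ => zero_le_one.trans (one_le_phi _)
        have := htime hj
        have := Nat.mul_pos j.succ_pos (H.pos n)
        exact Finset.mem_range.2 (by lia)

theorem measureReal_exceedanceSet_le_one_div_log (H : IsConvergentSeq α p q) {ε : ℝ}
    (hε : 0 < ε) {n N : ℕ} (hN : 2 / ε ≤ Real.log (((N / q n : ℕ) + 2) / 2)) :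
    volume.real (exceedanceSet α ε N) ≤
      4 / (ε * q (n + 1)) * (1 / Real.log (((N / q n : ℕ) + 2) / 2)) := by
  set l := Real.log (((N / q n : ℕ) + 2) / 2)
  have hl : 0 < l := hN.trans_lt' (by positivity)
  have hq := H.cast_pos (n + 1)
  refine (measureReal_exceedanceSet_le (r := 2 / (ε * q (n + 1) * l)) (by positivity)
    fun x hmem hx => ?_).trans_eq (by field_simp; norm_num)
  set y := ‖x + N • (α : UnitAddCircle)‖
  have hy0 : 0 < y := norm_pos_iff.2 (hx N)
  have hlt : y * (l / max y (1 / q (n + 1))) < 2 / ε :=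
    (mul_le_mul_of_nonneg_left (H.log_div_max_le_birkhoffSum n N hx) hy0.le).trans_lt
      (norm_mul_birkhoffSum_lt_of_mem_exceedanceSet hε (hx N) hmem)
  have hmax : max y (1 / q (n + 1)) = 1 / q (n + 1) := by
    refine (max_choice y _).resolve_left fun h => ?_
    rw [h, mul_div_cancel₀ _ hy0.ne'] at hlt
    exact hlt.not_ge hN
  rw [hmax, lt_div_iff₀ hε] at hlt
  rw [le_div_iff₀ (by positivity)]
  calc y * (ε * q (n + 1) * l) = y * (l / (1 / q (n + 1))) * ε := by field_simp
    _ ≤ 2 := hlt.le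

theorem sum_measureReal_exceedanceSet_le (H : IsConvergentSeq α p q) {ε : ℝ} (hε : 0 < ε)
    {n : ℕ} (hn : 1 < q n) {B : ℕ} (hB : q n ≤ B) :
    ∑ N ∈ Finset.Ico (q n) B, volume.real (exceedanceSet α ε N) ≤
      16 / (ε * Real.log (q n)) * (1 / q n + Real.log (B / q n)) := by
  have : 0 ≤ Real.log (q n) := Real.log_nonneg (H.one_le_cast n)
  have : (0 : ℝ) ≤ 1 / B := by positivity
  calc ∑ N ∈ Finset.Ico (q n) B, volume.real (exceedanceSet α ε N)
      ≤ 16 / (ε * Real.log (q n)) * ∑ N ∈ Finset.Ico (q n) B, (1 : ℝ) / N := by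
        rw [Finset.mul_sum]
        exact Finset.sum_le_sum fun N hN =>
          H.measureReal_exceedanceSet_le_one_div hε hn (Finset.mem_Ico.1 hN).1
    _ ≤ 16 / (ε * Real.log (q n)) * (1 / q n + Real.log (B / q n)) := by
        gcongr
        linarith [sum_Ico_one_div_le (H.pos n) hB]

end IsConvergentSeq

end Exceedance

section Convergence

open MeasureTheory

theorem summable_of_sum_Ico_le {f c : ℕ → ℝ} {q : ℕ → ℕ} (hf : ∀ N, 0 ≤ f N) (hq : Monotone q)
    (hle : ∀ n, n ≤ q n) (hc : Summable c)
    (h : ∀ n, ∑ N ∈ Finset.Ico (q n) (q (n + 1)), f N ≤ c n) : Summable f := by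
  have hc0 (n : ℕ) : 0 ≤ c n := (Finset.sum_nonneg fun N _ => hf N).trans (h n)
  have hblocks (n : ℕ) : ∑ N ∈ Finset.range (q n), f N ≤
      ∑ N ∈ Finset.range (q 0), f N + ∑ i ∈ Finset.range n, c i := by
    induction n with
    | zero => simp
    | succ n ih =>
      rw [← Finset.sum_range_add_sum_Ico f (hq n.le_succ), Finset.sum_range_succ]
      linarith [h n]
  refine summable_of_sum_range_le (c := ∑ N ∈ Finset.range (q 0), f N + ∑' i, c i) hf fun n =>
    (Finset.sum_le_sum_of_subset_of_nonneg (Finset.range_subset_range.2 (hle n))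
      fun N _ _ => hf N).trans ((hblocks n).trans ?_)
  exact add_le_add_right (hc.sum_le_tsum _ fun i _ => hc0 i) _

theorem growthWeight_nonneg {Q Q' : ℝ} (hQ : 1 ≤ Q) (hQQ' : Q ≤ Q') : 0 ≤ growthWeight Q Q' := by
  have hlog := Real.log_nonneg hQ
  unfold growthWeight
  split_ifs
  · exact div_nonneg (sub_nonneg.2 (Real.log_le_log (by linarith) hQQ')) hlog
  · exact div_nonneg (zero_le_one.trans (le_max_left _ _)) hlog

namespace IsConvergentSeq

variable {α : ℝ} {p : ℕ → ℤ} {q : ℕ → ℕ}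

theorem growthWeight_succ_nonneg (H : IsConvergentSeq α p q) (n : ℕ) :
    0 ≤ growthWeight (q n) (q (n + 1)) :=
  growthWeight_nonneg (H.one_le_cast n) (by exact_mod_cast H.le_succ n)

theorem measureReal_exceedanceSet_le_ite (H : IsConvergentSeq α p q) {ε b : ℝ} (hε : 0 < ε)
    (hb : 2 * Real.exp (2 / ε) ≤ b) {n N : ℕ} (hn : 1 < q n) (hN : q n ≤ N) (Y : ℝ) :
    volume.real (exceedanceSet α ε N) ≤
      16 / (ε * Real.log (q n)) * (if Y ≤ N then (1 : ℝ) / N else 0) +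
      4 / (ε * q (n + 1)) *
        (if (N : ℝ) < Y then 1 / Real.log (((N / q n : ℕ) + 2) / 2) else 0) +
      16 / (ε * Real.log (q n)) * (if (N : ℝ) < b * q n then (1 : ℝ) / N else 0) := by
  have := Real.log_nonneg (H.one_le_cast n)
  have hdiv : (1 : ℝ) ≤ (N / q n : ℕ) := by exact_mod_cast Nat.div_pos hN (H.pos n)
  have hl : 0 ≤ Real.log (((N / q n : ℕ) + 2) / 2) := Real.log_nonneg (by linarith)
  have htriv := H.measureReal_exceedanceSet_le_one_div hε hn hN
  have hfirst : 0 ≤ 16 / (ε * Real.log (q n)) * (if Y ≤ N then (1 : ℝ) / N else 0) := by positivity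
  have hlast : 0 ≤ 16 / (ε * Real.log (q n)) * (if (N : ℝ) < b * q n then (1 : ℝ) / N else 0) := by
    positivity
  rcases le_or_gt Y N with hY | hY
  · rw [if_pos hY, if_neg hY.not_gt]
    linarith
  rw [if_pos hY]
  rcases le_or_gt (2 / ε) (Real.log (((N / q n : ℕ) + 2) / 2)) with h | h
  · linarith [H.measureReal_exceedanceSet_le_one_div_log hε h]
  · have hsmall : (N : ℝ) < b * q n := by
      rw [Real.log_lt_iff_lt_exp (by linarith)] at h
      have hlt : (N : ℝ) < (N / q n : ℕ) * q n + q n := by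
        exact_mod_cast Nat.lt_div_mul_add (H.pos n)
      nlinarith [H.cast_pos n]
    rw [if_pos hsmall]
    have : 0 ≤ 4 / (ε * q (n + 1)) * (1 / Real.log (((N / q n : ℕ) + 2) / 2)) := by positivity
    linarith

theorem sum_measureReal_exceedanceSet_le_of_le (H : IsConvergentSeq α p q) {ε : ℝ} {b : ℕ}
    (hε : 0 < ε) (hb : 2 * Real.exp (2 / ε) ≤ b) {n : ℕ} (hn : 1 < q n)
    (h : 2 * q n * Real.log (q n) ≤ q (n + 1)) :
    ∑ N ∈ Finset.Ico (q n) (q (n + 1)), volume.real (exceedanceSet α ε N) ≤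
      (60 + 16 * Real.log b) / ε * growthWeight (q n) (q (n + 1)) +
        32 / (ε * Real.log (q n)) * (1 / q n) := by
  have := H.cast_pos n
  have := H.cast_pos (n + 1)
  have hL : 0 < Real.log (q n) := Real.log_pos (by exact_mod_cast hn)
  set L := Real.log (q n)
  set Z : ℝ := q (n + 1) / (q n * L) with hZ
  have hZ2 : 2 ≤ Z := (le_div_iff₀ (by positivity)).2 (by linarith)
  have hZL : Z * q n * L = q (n + 1) := by rw [hZ]; field_simp
  have hb0 : 0 < b := by
    have : (0 : ℝ) < b := hb.trans_lt' (by positivity)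
    exact_mod_cast this
  have hlarge := sum_filter_one_div_le (Q := q n) (Q' := q (n + 1)) (H.pos n) hL hZ2 hZL
  have hmiddle := sum_filter_one_div_log_le (Q := q n) (Q' := q (n + 1)) (H.pos n) hZ2
  have hsmall := sum_filter_lt_mul_one_div_le (Q := q n) (Q' := q (n + 1)) (H.pos n) hb0
  set D := max 1 (Real.log L - Real.log (Real.log Z))
  have hweight : growthWeight (q n) (q (n + 1)) = D / L := if_neg h.not_gt
  have hlogb : Real.log b ≤ Real.log b * D :=
    le_mul_of_one_le_right (Real.log_natCast_nonneg b) (le_max_left _ _)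
  calc ∑ N ∈ Finset.Ico (q n) (q (n + 1)), volume.real (exceedanceSet α ε N)
      ≤ 16 / (ε * L) * (1 / q n + D) + 4 / (ε * q (n + 1)) * (q n * (11 * Z)) +
          16 / (ε * L) * (1 / q n + Real.log b) := by
        refine (Finset.sum_le_sum fun N hN => H.measureReal_exceedanceSet_le_ite hε hb hn
          (Finset.mem_Ico.1 hN).1 (Z * (1 + Real.log Z) * q n)).trans ?_
        simp only [Finset.sum_add_distrib, ← Finset.mul_sum, ← Finset.sum_filter]
        gcongr
    _ = 1 / (ε * L) * (16 * D + 44 + 16 * Real.log b) + 32 / (ε * L) * (1 / q n) := by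
        rw [← hZL]
        field_simp
        ring
    _ ≤ 1 / (ε * L) * ((60 + 16 * Real.log b) * D) + 32 / (ε * L) * (1 / q n) := by
        gcongr
        linarith [le_max_left 1 (Real.log L - Real.log (Real.log Z))]
    _ = (60 + 16 * Real.log b) / ε * growthWeight (q n) (q (n + 1)) +
          32 / (ε * L) * (1 / q n) := by
        rw [hweight]
        field_simp

theorem exists_sum_measureReal_exceedanceSet_le (H : IsConvergentSeq α p q) {ε : ℝ}
    (hε : 0 < ε) : ∃ K : ℝ, ∀ n, 3 ≤ q n →
      ∑ N ∈ Finset.Ico (q n) (q (n + 1)), volume.real (exceedanceSet α ε N) ≤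
        K * (growthWeight (q n) (q (n + 1)) + 1 / q n) := by
  set b := ⌈2 * Real.exp (2 / ε)⌉₊
  have hlogb : 0 ≤ Real.log b := Real.log_natCast_nonneg b
  refine ⟨(60 + 16 * Real.log b) / ε, fun n hn => ?_⟩
  have hn3 : (3 : ℝ) ≤ q n := by exact_mod_cast hn
  have hL : 1 ≤ Real.log (q n) := by
    rw [Real.le_log_iff_exp_le (by linarith)]
    linarith [Real.exp_one_lt_d9]
  have hweight := H.growthWeight_succ_nonneg n
  rcases le_or_gt (2 * q n * Real.log (q n)) (q (n + 1)) with h | h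
  · refine (H.sum_measureReal_exceedanceSet_le_of_le hε (Nat.le_ceil _) (by lia) h).trans ?_
    rw [mul_add]
    gcongr
    · linarith
    · exact le_mul_of_one_le_right hε.le hL
  · refine (H.sum_measureReal_exceedanceSet_le hε (by lia) (H.le_succ n)).trans ?_
    have hdef : growthWeight (q n) (q (n + 1)) =
        Real.log (q (n + 1) / q n) / Real.log (q n) := by
      rw [Real.log_div (H.cast_pos _).ne' (H.cast_pos _).ne']
      exact if_pos h
    have : 1 / q n / Real.log (q n) ≤ 1 / q n := div_le_self (by positivity) hL
    calc 16 / (ε * Real.log (q n)) * (1 / q n + Real.log (q (n + 1) / q n))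
        = 16 / ε * (growthWeight (q n) (q (n + 1)) + 1 / q n / Real.log (q n)) := by
          rw [hdef]
          field_simp
          ring
      _ ≤ (60 + 16 * Real.log b) / ε * (growthWeight (q n) (q (n + 1)) + 1 / q n) := by
          gcongr
          linarith

theorem summable_one_div (H : IsConvergentSeq α p q) : Summable fun n => 1 / (q n : ℝ) := by
  have hle (n : ℕ) : 2 ^ n ≤ q (2 * n) := by
    induction n with
    | zero => exact H.pos 0
    | succ n ih =>
      have := H.two_mul_le (2 * n)
      rw [pow_succ, mul_add, mul_one]
      lia
  have heven : Summable fun n => 1 / (q (2 * n) : ℝ) :=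
    summable_geometric_two.of_nonneg_of_le (fun n => by positivity) fun n => by
      rw [one_div_pow]
      exact one_div_le_one_div_of_le (by positivity) (by exact_mod_cast hle n)
  have hodd : Summable fun n => 1 / (q (2 * n + 1) : ℝ) :=
    heven.of_nonneg_of_le (fun n => by positivity) fun n =>
      one_div_le_one_div_of_le (H.cast_pos _) (by exact_mod_cast H.le_succ _)
  exact (HasSum.even_add_odd (f := fun n => 1 / (q n : ℝ)) heven.hasSum hodd.hasSum).summable

theorem summable_measureReal_exceedanceSet (H : IsConvergentSeq α p q)
    (hsum : Summable fun n => growthWeight (q n) (q (n + 1))) {ε : ℝ} (hε : 0 < ε) :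
    Summable fun N => volume.real (exceedanceSet α ε N) := by
  obtain ⟨K, hK⟩ := H.exists_sum_measureReal_exceedanceSet_le hε
  refine summable_of_sum_Ico_le (q := fun n => q (n + 3)) (fun _ => measureReal_nonneg)
    (H.monotone.comp fun _ _ h => Nat.add_le_add_right h 3)
    (fun n => (n.le_add_right 3).trans (H.le_self _))
    ((summable_nat_add_iff 3).2 ((hsum.add H.summable_one_div).mul_left K)) fun n => ?_
  rw [Nat.add_right_comm]
  exact hK _ ((Nat.le_add_left 3 n).trans (H.le_self _))

theorem ae_eventually_phi_le (H : IsConvergentSeq α p q)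
    (hsum : Summable fun n => growthWeight (q n) (q (n + 1))) {ε : ℝ} (hε : 0 < ε) :
    ∀ᵐ x : UnitAddCircle, ∀ᶠ N in Filter.atTop,
      phi (x + N • (α : UnitAddCircle)) ≤ ε * birkhoffSum (torusRotation α) phi N x := by
  have hfinite := (H.summable_measureReal_exceedanceSet hsum hε).tsum_ofReal_ne_top
  simp only [measureReal_def, ENNReal.ofReal_toReal (measure_ne_top _ _)] at hfinite
  filter_upwards [ae_eventually_notMem hfinite] with x hx
  exact hx.mono fun N hN => not_lt.1 hN

end IsConvergentSeq

theorem extravagance_eq_zero {α : ℝ} {x : UnitAddCircle}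
    (h : ∀ m : ℕ, ∀ᶠ N in Filter.atTop, phi (x + N • (α : UnitAddCircle)) ≤
      1 / (m + 1 : ℝ) * birkhoffSum (torusRotation α) phi N x) : extravagance α x = 0 := by
  have hnonneg (N : ℕ) : 0 ≤ birkhoffSum (torusRotation α) phi N x :=
    N.cast_nonneg.trans (natCast_le_birkhoffSum_phi _ N x)
  have hlim : Filter.Tendsto (fun N : ℕ => phi (x + N • (α : UnitAddCircle)) /
      birkhoffSum (torusRotation α) phi N x) Filter.atTop (nhds 0) := by
    refine tendsto_order.2 ⟨fun a ha => Filter.Eventually.of_forall fun N => ha.trans_le <|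
      div_nonneg (zero_le_one.trans (one_le_phi _)) (hnonneg N), fun a ha => ?_⟩
    obtain ⟨m, hm⟩ := exists_nat_one_div_lt ha
    exact (h m).mono fun N hN =>
      (div_le_of_le_mul₀ (hnonneg N) (by positivity) hN).trans_lt hm
  simp only [extravagance, torusRotation_iterate]
  exact ((continuous_coe_real_ereal.tendsto 0).comp hlim).limsup_eq

theorem IsConvergentSeq.ae_extravagance_eq_zero {α : ℝ} {p : ℕ → ℤ} {q : ℕ → ℕ}
    (H : IsConvergentSeq α p q) (hsum : Summable fun n => growthWeight (q n) (q (n + 1))) :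
    ∀ᵐ x : UnitAddCircle, extravagance α x = 0 := by
  filter_upwards [ae_all_iff.2 fun m : ℕ =>
    H.ae_eventually_phi_le hsum (Nat.one_div_pos_of_nat (α := ℝ) (n := m))] with x hx
  exact extravagance_eq_zero hx

end Convergence

section KochenStone

open MeasureTheory Filter

theorem sum_Ico_sum_Ico_le_of_symm {g : ℕ → ℕ → ℝ} (hg : ∀ i j, 0 ≤ g i j)
    (hsymm : ∀ i j, g i j = g j i) {a b : ℕ} (hab : a ≤ b) :
    ∑ i ∈ Finset.Ico a b, ∑ j ∈ Finset.Ico a b, g i j ≤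
      ∑ n ∈ Finset.Ico a b, (g n n + 2 * ∑ m ∈ Finset.range n, g m n) := by
  induction b, hab using Nat.le_induction with
  | base => simp
  | succ b hb ih =>
    have hle : ∑ i ∈ Finset.Ico a b, g i b ≤ ∑ m ∈ Finset.range b, g m b :=
      Finset.sum_le_sum_of_subset_of_nonneg
        (fun i hi => Finset.mem_range.2 (Finset.mem_Ico.1 hi).2) fun _ _ _ => hg _ _
    simp only [Finset.sum_Ico_succ_top hb, Finset.sum_add_distrib, hsymm b] at ih ⊢
    linarith

variable {Ω : Type*} [MeasurableSpace Ω] {μ : Measure Ω} [IsFiniteMeasure μ]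

/-- The Chung–Erdős inequality is the Cauchy–Schwarz inequality for `∑ i ∈ T, 1_{A i}` and the
indicator function of the union, in `L²`. -/
theorem sq_sum_measureReal_le {ι : Type*} (T : Finset ι) {A : ι → Set Ω}
    (hA : ∀ i, MeasurableSet (A i)) :
    (∑ i ∈ T, μ.real (A i)) ^ 2 ≤
      (∑ i ∈ T, ∑ j ∈ T, μ.real (A i ∩ A j)) * μ.real (⋃ i ∈ T, A i) := by
  have hU : MeasurableSet (⋃ i ∈ T, A i) := T.measurableSet_biUnion fun i _ => hA i
  let f : Lp ℝ 2 μ := ∑ i ∈ T, indicatorConstLp 2 (hA i) (measure_ne_top μ _) (1 : ℝ)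
  let u : Lp ℝ 2 μ := indicatorConstLp 2 hU (measure_ne_top μ _) (1 : ℝ)
  have hff : inner ℝ f f = ∑ i ∈ T, ∑ j ∈ T, μ.real (A i ∩ A j) := by
    simp only [f, sum_inner, inner_sum, L2.real_inner_indicatorConstLp_one_indicatorConstLp_one]
    exact Finset.sum_comm
  have huu : inner ℝ u u = μ.real (⋃ i ∈ T, A i) := by
    simp only [u, L2.real_inner_indicatorConstLp_one_indicatorConstLp_one, Set.inter_self]
  have hfu : inner ℝ f u = ∑ i ∈ T, μ.real (A i) := by
    simp only [f, u, sum_inner, L2.real_inner_indicatorConstLp_one_indicatorConstLp_one]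
    exact Finset.sum_congr rfl fun i hi => by
      rw [Set.inter_eq_left.2 (Set.subset_iUnion₂ (s := fun i (_ : i ∈ T) => A i) i hi)]
  rw [← hff, ← huu, ← hfu, sq]
  exact real_inner_mul_inner_self_le f u

theorem one_div_le_measureReal_iUnion_ge {A : ℕ → Set Ω} (hA : ∀ n, MeasurableSet (A n))
    (hdiv : ¬Summable fun n => μ.real (A n)) {K : ℝ} (hK0 : 0 ≤ K)
    (hK : ∀ n, ∑ m ∈ Finset.range n, μ.real (A m ∩ A n) ≤
      K * (∑ m ∈ Finset.range n, μ.real (A m) + 1) * μ.real (A n)) (a : ℕ) :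
    1 / (1 + 4 * K) ≤ μ.real (⋃ n ≥ a, A n) := by
  have hnonneg (n : ℕ) : 0 ≤ μ.real (A n) := measureReal_nonneg
  have hlim := (not_summable_iff_tendsto_nat_atTop_of_nonneg hnonneg).1 hdiv
  set S : ℕ → ℝ := fun n => ∑ m ∈ Finset.range n, μ.real (A m)
  obtain ⟨b, hab, hb⟩ :=
    ((eventually_ge_atTop a).and (hlim.eventually_ge_atTop (2 * S a + 2))).exists
  set s := ∑ n ∈ Finset.Ico a b, μ.real (A n)
  have hs : S a + s = S b := Finset.sum_range_add_sum_Ico _ hab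
  have hSa : 0 ≤ S a := Finset.sum_nonneg fun _ _ => hnonneg _
  have hs0 : 0 < s := by linarith
  have hpairs : ∑ i ∈ Finset.Ico a b, ∑ j ∈ Finset.Ico a b, μ.real (A i ∩ A j) ≤
      (1 + 4 * K) * s ^ 2 := calc
    _ ≤ ∑ n ∈ Finset.Ico a b, (μ.real (A n ∩ A n) +
          2 * ∑ m ∈ Finset.range n, μ.real (A m ∩ A n)) :=
        sum_Ico_sum_Ico_le_of_symm (fun _ _ => measureReal_nonneg)
          (fun _ _ => by rw [Set.inter_comm]) hab
    _ ≤ ∑ n ∈ Finset.Ico a b, (μ.real (A n) + 2 * (K * (S b + 1) * μ.real (A n))) := by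
        simp only [Set.inter_self]
        gcongr with n hn
        refine (hK n).trans (mul_le_mul_of_nonneg_right ?_ (hnonneg n))
        gcongr
        exact Finset.sum_le_sum_of_subset_of_nonneg
          (Finset.range_subset_range.2 (Finset.mem_Ico.1 hn).2.le) fun _ _ _ => hnonneg _
    _ = (1 + 2 * K * (S b + 1)) * s := by
        rw [Finset.mul_sum]
        exact Finset.sum_congr rfl fun n _ => by ring
    _ ≤ (1 + 4 * K) * s * s := by
        gcongr
        nlinarith
    _ = (1 + 4 * K) * s ^ 2 := by ring
  have hunion : μ.real (⋃ n ∈ Finset.Ico a b, A n) ≤ μ.real (⋃ n ≥ a, A n) :=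
    measureReal_mono (Set.biUnion_subset_biUnion_left fun _ hn => (Finset.mem_Ico.1 hn).1)
      (measure_ne_top _ _)
  rw [div_le_iff₀ (by positivity)]
  refine le_of_mul_le_mul_right ?_ (pow_pos hs0 2)
  calc 1 * s ^ 2 ≤ (1 + 4 * K) * s ^ 2 * μ.real (⋃ n ≥ a, A n) := by
        rw [one_mul]
        exact (sq_sum_measureReal_le _ hA).trans
          (mul_le_mul hpairs hunion measureReal_nonneg (by positivity))
    _ = μ.real (⋃ n ≥ a, A n) * (1 + 4 * K) * s ^ 2 := by ring

theorem measure_limsup_atTop_pos {A : ℕ → Set Ω} (hA : ∀ n, MeasurableSet (A n))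
    (hdiv : ¬Summable fun n => μ.real (A n)) {K : ℝ} (hK0 : 0 ≤ K)
    (hK : ∀ n, ∑ m ∈ Finset.range n, μ.real (A m ∩ A n) ≤
      K * (∑ m ∈ Finset.range n, μ.real (A m) + 1) * μ.real (A n)) :
    0 < μ (limsup A atTop) := by
  have hanti : Antitone fun a => ⋃ n ≥ a, A n := fun a b hab =>
    Set.biUnion_subset_biUnion_left fun n hn => hab.trans hn
  have hlim := tendsto_measure_iInter_atTop (μ := μ)
    (fun a => (MeasurableSet.iUnion fun n =>
      MeasurableSet.iUnion fun _ : n ≥ a => hA n).nullMeasurableSet)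
    hanti ⟨0, measure_ne_top _ _⟩
  rw [limsup_eq_iInf_iSup_of_nat]
  refine (ENNReal.ofReal_pos.2 (by positivity : 0 < 1 / (1 + 4 * K))).trans_le
    (ge_of_tendsto' hlim fun a => ?_)
  exact (ENNReal.ofReal_le_iff_le_toReal (measure_ne_top _ _)).2
    (one_div_le_measureReal_iUnion_ge hA hdiv hK0 hK a)

end KochenStone

section Visits

theorem div_three_mul_le_sum_Ico_one_div {P l k : ℕ} (hl : 0 < l) (hP : l ≤ P) (h1 : l ≤ k)
    (h2 : k ≤ 2 * l) : (l : ℝ) / (3 * P) ≤ ∑ N ∈ Finset.Ico P (P + k), (1 : ℝ) / N := by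
  calc (l : ℝ) / (3 * P) ≤ k * (1 / (3 * P)) := by
        rw [div_eq_mul_one_div]
        gcongr
    _ = ∑ N ∈ Finset.Ico P (P + k), (1 : ℝ) / (3 * P) := by simp
    _ ≤ ∑ N ∈ Finset.Ico P (P + k), (1 : ℝ) / N := by
        refine Finset.sum_le_sum fun N hN => ?_
        rw [Finset.mem_Ico] at hN
        exact one_div_le_one_div_of_le (by exact_mod_cast hl.trans_le (hP.trans hN.1))
          (by exact_mod_cast (by lia : N ≤ 3 * P))

namespace IsConvergentSeq

variable {α : ℝ} {p : ℕ → ℤ} {q : ℕ → ℕ}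

theorem card_filter_norm_add_nsmul_le (H : IsConvergentSeq α p q) (n : ℕ) (z : UnitAddCircle)
    {R : ℝ} (hR : 0 ≤ R) (P : ℕ) :
    (((Finset.Ico P (P + q (n + 1))).filter
      fun N : ℕ => ‖z + N • (α : UnitAddCircle)‖ ≤ R).card : ℝ) ≤ 4 * q (n + 1) * R + 2 := by
  have hq := H.cast_pos (n + 1)
  refine (card_le_of_norm_le_of_pairwise (z := fun N : ℕ => z + N • (α : UnitAddCircle))
    (δ := 1 / (2 * q (n + 1))) (by positivity) hR (fun _ hN => (Finset.mem_filter.1 hN).2)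
    ((H.pairwise_le_norm_sub n P z).mono fun N hN => ?_)).trans_eq ?_
  · exact Finset.mem_Ico.1 (Finset.mem_filter.1 (Finset.mem_coe.1 hN)).1
  · field_simp
    ring

theorem sum_filter_norm_le_one_div_le_of_lt_two_mul (H : IsConvergentSeq α p q) (n : ℕ)
    (z : UnitAddCircle) {R : ℝ} (hR : 0 ≤ R) {P k : ℕ} (hP : q (n + 1) ≤ P)
    (h1 : q (n + 1) ≤ k) (h2 : k < 2 * q (n + 1)) :
    ∑ N ∈ (Finset.Ico P (P + k)).filter (fun N : ℕ => ‖z + N • (α : UnitAddCircle)‖ ≤ R),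
      (1 : ℝ) / N ≤ 24 * (R + 1 / q (n + 1)) * ∑ N ∈ Finset.Ico P (P + k), (1 : ℝ) / N := by
  set l := q (n + 1)
  set near : ℕ → Prop := fun N => ‖z + N • (α : UnitAddCircle)‖ ≤ R
  have hl : (0 : ℝ) < l := H.cast_pos (n + 1)
  have hP0 : (0 : ℝ) < P := by exact_mod_cast (H.pos (n + 1)).trans_le hP
  have hcard : (((Finset.Ico P (P + k)).filter near).card : ℝ) ≤ 2 * (4 * l * R + 2) := by
    have hsub : (Finset.Ico P (P + k)).filter near ⊆
        (Finset.Ico P (P + l)).filter near ∪ (Finset.Ico (P + l) (P + l + l)).filter near := by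
      rw [← Finset.filter_union, Finset.Ico_union_Ico_eq_Ico (by lia) (by lia)]
      exact Finset.filter_subset_filter _ (Finset.Ico_subset_Ico_right (by lia))
    have hunion : (((Finset.Ico P (P + k)).filter near).card : ℝ) ≤
        ((Finset.Ico P (P + l)).filter near).card +
          ((Finset.Ico (P + l) (P + l + l)).filter near).card := by
      exact_mod_cast (Finset.card_le_card hsub).trans (Finset.card_union_le _ _)
    linarith [H.card_filter_norm_add_nsmul_le n z hR P,
      H.card_filter_norm_add_nsmul_le n z hR (P + l)]
  calc ∑ N ∈ (Finset.Ico P (P + k)).filter near, (1 : ℝ) / N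
      ≤ ((Finset.Ico P (P + k)).filter near).card • ((1 : ℝ) / P) :=
        Finset.sum_le_card_nsmul _ _ _ fun _ hN => one_div_le_one_div_of_le hP0
          (by exact_mod_cast (Finset.mem_Ico.1 (Finset.mem_filter.1 hN).1).1)
    _ ≤ 2 * (4 * l * R + 2) * (1 / P) := by
        rw [nsmul_eq_mul]
        gcongr
    _ ≤ 2 * (4 * l * R + 4) * (1 / P) := by
        gcongr
        norm_num
    _ = 24 * (R + 1 / l) * (l / (3 * P)) := by
        field_simp
        ring
    _ ≤ 24 * (R + 1 / l) * ∑ N ∈ Finset.Ico P (P + k), (1 : ℝ) / N := by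
        gcongr
        exact div_three_mul_le_sum_Ico_one_div (H.pos (n + 1)) hP h1 h2.le

theorem sum_filter_norm_le_one_div_le (H : IsConvergentSeq α p q) (n : ℕ) (z : UnitAddCircle)
    {R : ℝ} (hR : 0 ≤ R) {P k : ℕ} (hP : q (n + 1) ≤ P) (hk : q (n + 1) ≤ k) :
    ∑ N ∈ (Finset.Ico P (P + k)).filter (fun N : ℕ => ‖z + N • (α : UnitAddCircle)‖ ≤ R),
      (1 : ℝ) / N ≤ 24 * (R + 1 / q (n + 1)) * ∑ N ∈ Finset.Ico P (P + k), (1 : ℝ) / N := by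
  induction k using Nat.strong_induction_on generalizing P with
  | _ k ih =>
    obtain h2 | h2 := lt_or_ge k (2 * q (n + 1))
    · exact H.sum_filter_norm_le_one_div_le_of_lt_two_mul n z hR hP hk h2
    · obtain ⟨m, rfl⟩ := Nat.exists_eq_add_of_le hk
      have hpos := H.pos (n + 1)
      have hblock :=
        H.sum_filter_norm_le_one_div_le_of_lt_two_mul n z hR hP le_rfl (by lia)
      have hrest := ih m (by lia) (P := P + q (n + 1)) (by lia) (by lia)
      rw [add_assoc] at hrest
      rw [Finset.sum_filter] at hblock hrest ⊢
      rw [← Finset.sum_Ico_consecutive _ (by lia : P ≤ P + q (n + 1))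
          (by lia : P + q (n + 1) ≤ P + (q (n + 1) + m)),
        ← Finset.sum_Ico_consecutive _ (by lia : P ≤ P + q (n + 1))
          (by lia : P + q (n + 1) ≤ P + (q (n + 1) + m)), mul_add]
      exact add_le_add hblock hrest

end IsConvergentSeq

end Visits

/-- The ratio `q_{n+1} / (q_n log q_n)` as a function of two consecutive denominators `Q = q_n`
and `Q' = q_{n+1}`; the definition of `growthWeight` distinguishes whether it is less than `2`. -/
noncomputable def growthRatio (Q Q' : ℝ) : ℝ := Q' / (Q * Real.log Q)

/-- For `2 ≤ Z = growthRatio Q Q'`, the time `N ≈ Z (1 + log Z) Q` at which the part `N log Q` of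
the Birkhoff sums overtakes the part `Q' (1 + log (N / Q))` that comes from the close returns. -/
noncomputable def criticalTime (Q Q' : ℕ) : ℕ :=
  ⌈growthRatio Q Q' * (1 + Real.log (growthRatio Q Q')) * Q⌉₊

/-- The least time in `[Q, Q']` from which on the close returns do not dominate the Birkhoff sums.
It is set to `Q'` when the critical time is past `Q' / 2`, so that the remaining interval of
times is either empty or long. -/
noncomputable def startTime (Q Q' : ℕ) : ℕ :=
  if growthRatio Q Q' < 2 then Q
  else if 2 * criticalTime Q Q' ≤ Q' then criticalTime Q Q' else Q'

section StartTime

theorem one_le_log_of_three_le {x : ℝ} (hx : 3 ≤ x) : 1 ≤ Real.log x := by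
  rw [Real.le_log_iff_exp_le (by linarith)]
  linarith [Real.exp_one_lt_d9]

section Real

variable {Q Q' : ℝ}

theorem growthRatio_mul_mul_log (hQ : 1 < Q) : growthRatio Q Q' * Q * Real.log Q = Q' := by
  have := Real.log_pos hQ
  rw [growthRatio]
  field_simp

theorem growthRatio_lt_two_iff (hQ : 1 < Q) :
    growthRatio Q Q' < 2 ↔ Q' < 2 * Q * Real.log Q := by
  have := Real.log_pos hQ
  rw [growthRatio, div_lt_iff₀ (by positivity), mul_assoc]

theorem growthWeight_of_growthRatio_lt_two (hQ : 1 < Q) (hZ : growthRatio Q Q' < 2) :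
    growthWeight Q Q' = (Real.log Q' - Real.log Q) / Real.log Q :=
  if_pos ((growthRatio_lt_two_iff hQ).1 hZ)

theorem growthWeight_of_two_le_growthRatio (hQ : 1 < Q) (hZ : 2 ≤ growthRatio Q Q') :
    growthWeight Q Q' =
      max 1 (Real.log (Real.log Q) - Real.log (Real.log (growthRatio Q Q'))) / Real.log Q :=
  if_neg fun h => ((growthRatio_lt_two_iff hQ).2 h).not_ge hZ

theorem log_add_log_growthRatio_le (hQ : 3 ≤ Q) (hZ : 0 < growthRatio Q Q') :
    Real.log Q + Real.log (growthRatio Q Q') ≤ Real.log Q' := by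
  rw [← Real.log_mul (by linarith) hZ.ne']
  refine Real.log_le_log (by positivity) ?_
  calc Q * growthRatio Q Q' = growthRatio Q Q' * Q * 1 := by ring
    _ ≤ growthRatio Q Q' * Q * Real.log Q := by
        gcongr
        exact one_le_log_of_three_le hQ
    _ = Q' := growthRatio_mul_mul_log (by linarith)

theorem one_div_le_mul_one_div_sub_one_div {K L l L' : ℝ} (hK : 0 ≤ K) (hL : 0 < L) (hl : 0 ≤ l)
    (hLl : L ≤ K * l) (hL' : L + l ≤ L') : 1 / L ≤ (K + 1) * (1 / L - 1 / L') := by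
  have hL'0 : 0 < L' := by linarith
  have hkey : 0 ≤ (K * L' - (K + 1) * L) / (L * L') :=
    div_nonneg (by nlinarith) (by positivity)
  have hsub : (K + 1) * (1 / L - 1 / L') - 1 / L = (K * L' - (K + 1) * L) / (L * L') := by
    field_simp
    ring
  linarith

theorem max_one_div_log_le (hQ : 3 ≤ Q) (hZ : 2 ≤ growthRatio Q Q')
    (h4 : Real.log (Real.log Q) - Real.log (Real.log (growthRatio Q Q')) < 4) :
    max 1 (Real.log (Real.log Q) - Real.log (Real.log (growthRatio Q Q'))) / Real.log Q ≤
      4 * (Real.exp 4 + 1) * (1 / Real.log Q - 1 / Real.log Q') := by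
  have hlogQ := one_le_log_of_three_le hQ
  have hl : 0 < Real.log (growthRatio Q Q') := Real.log_pos (by linarith)
  have hlogQ_le : Real.log Q ≤ Real.exp 4 * Real.log (growthRatio Q Q') := by
    rw [← Real.log_div (by linarith) hl.ne', Real.log_lt_iff_lt_exp (by positivity),
      div_lt_iff₀ hl] at h4
    exact h4.le
  have htel := one_div_le_mul_one_div_sub_one_div (Real.exp_pos 4).le (by linarith) hl.le
    hlogQ_le (log_add_log_growthRatio_le hQ (by linarith))
  calc max 1 (Real.log (Real.log Q) - Real.log (Real.log (growthRatio Q Q'))) / Real.log Q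
      ≤ 4 * (1 / Real.log Q) := by
        rw [mul_one_div]
        gcongr
        exact max_le (by norm_num) h4.le
    _ ≤ 4 * (Real.exp 4 + 1) * (1 / Real.log Q - 1 / Real.log Q') := by linarith

theorem mul_one_add_log_le {Z β : ℝ} (hZ : 2 ≤ Z) (hβ : Z * (1 + Real.log Z) ≤ β) :
    Z * (1 + Real.log (β + 1)) ≤ 4 * β := by
  have hlogZ : 0 ≤ Real.log Z := Real.log_nonneg (by linarith)
  have hβ2 : 2 ≤ β := by nlinarith
  have hlog : Real.log (β + 1) = Real.log Z + Real.log ((β + 1) / Z) := by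
    rw [← Real.log_mul (by linarith) (by positivity), mul_div_cancel₀ _ (by linarith)]
  calc Z * (1 + Real.log (β + 1)) = Z * (1 + Real.log Z) + Z * Real.log ((β + 1) / Z) := by
        rw [hlog]
        ring
    _ ≤ β + Z * ((β + 1) / Z) := by
        gcongr
        exact (Real.log_le_sub_one_of_pos (by positivity)).trans (by linarith)
    _ = β + (β + 1) := by rw [mul_div_cancel₀ _ (by linarith)]
    _ ≤ 4 * β := by linarith

end Real

variable {Q Q' : ℕ}

theorem le_criticalTime (hZ : 2 ≤ growthRatio Q Q') : Q ≤ criticalTime Q Q' := by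
  have hlogZ : 0 ≤ Real.log (growthRatio Q Q') := Real.log_nonneg (by linarith)
  have hX : 1 ≤ growthRatio Q Q' * (1 + Real.log (growthRatio Q Q')) := by nlinarith
  exact_mod_cast (le_mul_of_one_le_left Q.cast_nonneg hX).trans (Nat.le_ceil _)

theorem le_startTime (h : Q ≤ Q') : Q ≤ startTime Q Q' := by
  rw [startTime]
  split_ifs with h1
  exacts [le_rfl, le_criticalTime (not_lt.1 h1), h]

theorem startTime_le (h : Q ≤ Q') : startTime Q Q' ≤ Q' := by
  rw [startTime]
  split_ifs <;> lia

theorem startTime_add_le {r : ℕ} (hadd : Q + r ≤ Q') (hr : 2 * r ≤ Q') (h : startTime Q Q' < Q') :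
    startTime Q Q' + r ≤ Q' := by
  rw [startTime] at h ⊢
  split_ifs at h ⊢ <;> lia

theorem mul_log_le_of_startTime_le {N : ℕ} (hQ : 3 ≤ Q) (hQQ' : Q ≤ Q')
    (hN : startTime Q Q' ≤ N) (hN' : N < Q') :
    Q' * (1 + Real.log (N / Q + 1)) ≤ 4 * (N * Real.log Q) := by
  have hQ3 : (3 : ℝ) ≤ Q := by exact_mod_cast hQ
  have hlogQ := one_le_log_of_three_le hQ3
  have hQN : (Q : ℝ) ≤ N := by exact_mod_cast (le_startTime hQQ').trans hN
  have hβ : 1 ≤ (N / Q : ℝ) := (one_le_div (by linarith)).2 hQN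
  suffices h : growthRatio Q Q' * (1 + Real.log (N / Q + 1)) ≤ 4 * (N / Q) by
    calc Q' * (1 + Real.log (N / Q + 1))
        = growthRatio Q Q' * (1 + Real.log (N / Q + 1)) * (Q * Real.log Q) := by
          conv_lhs => rw [← growthRatio_mul_mul_log (Q' := Q') (by linarith : (1 : ℝ) < Q)]
          ring
      _ ≤ 4 * (N / Q) * (Q * Real.log Q) := by gcongr
      _ = 4 * (N * Real.log Q) := by field_simp
  rw [startTime] at hN
  split_ifs at hN with h1 h2
  · have := Real.log_le_sub_one_of_pos (by linarith : (0 : ℝ) < N / Q + 1)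
    have := Real.log_nonneg (by linarith : (1 : ℝ) ≤ N / Q + 1)
    nlinarith
  · refine mul_one_add_log_le (not_lt.1 h1) ((le_div_iff₀ (by linarith)).2 ?_)
    exact (Nat.le_ceil _).trans (by exact_mod_cast hN)
  · lia

theorem criticalTime_mul_le (hQ : 3 ≤ Q) (hZ : 2 ≤ growthRatio Q Q') :
    criticalTime Q Q' * (Real.log Q / (5 * Real.log (growthRatio Q Q'))) ≤ Q' := by
  set Z := growthRatio Q Q'
  have hQ3 : (3 : ℝ) ≤ Q := by exact_mod_cast hQ
  have hlogQ := one_le_log_of_three_le hQ3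
  have hlogZ : 2 / 3 ≤ Real.log Z := by
    linarith [Real.log_two_gt_d9, Real.log_le_log two_pos hZ]
  have hceil : (criticalTime Q Q' : ℝ) ≤ 2 * (Z * (1 + Real.log Z) * Q) := by
    have hX : 1 ≤ Z * (1 + Real.log Z) := by nlinarith
    have := (Nat.ceil_lt_add_one (by positivity : 0 ≤ Z * (1 + Real.log Z) * Q)).le
    rw [criticalTime]
    nlinarith
  calc criticalTime Q Q' * (Real.log Q / (5 * Real.log Z))
      ≤ 2 * (Z * (1 + Real.log Z) * Q) * (Real.log Q / (5 * Real.log Z)) := by gcongr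
    _ = Z * Q * Real.log Q * (2 * (1 + Real.log Z) / (5 * Real.log Z)) := by ring
    _ ≤ Z * Q * Real.log Q * 1 := by
        gcongr
        rw [div_le_one (by positivity)]
        linarith
    _ = Q' := by rw [mul_one, growthRatio_mul_mul_log (by linarith)]

theorem log_log_sub_log_log_le (hQ : 3 ≤ Q) (hZ : 2 ≤ growthRatio Q Q')
    (h4 : 4 ≤ Real.log (Real.log Q) - Real.log (Real.log (growthRatio Q Q'))) :
    Real.log (Real.log Q) - Real.log (Real.log (growthRatio Q Q')) ≤
      2 * Real.log (Q' / startTime Q Q') := by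
  set l := Real.log (growthRatio Q Q')
  have hl : 0 < l := Real.log_pos (by linarith)
  have hlogQ : 0 < Real.log Q := Real.log_pos (by exact_mod_cast (by lia : 1 < Q))
  rw [← Real.log_div hlogQ.ne' hl.ne'] at h4 ⊢
  have hratio : 10 ≤ Real.log Q / l := by
    have := Real.quadratic_le_exp_of_nonneg (by norm_num : (0 : ℝ) ≤ 4)
    have := (Real.le_log_iff_exp_le (by positivity)).1 h4
    linarith
  have hle := criticalTime_mul_le hQ hZ
  have hdiv : Real.log Q / (5 * l) = Real.log Q / l / 5 := by rw [mul_comm 5, div_div]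
  rw [hdiv] at hle
  have hstart : startTime Q Q' = criticalTime Q Q' := by
    rw [startTime, if_neg hZ.not_gt, if_pos]
    exact_mod_cast (by nlinarith : (2 * criticalTime Q Q' : ℝ) ≤ Q')
  have hcrit : (0 : ℝ) < criticalTime Q Q' := by
    exact_mod_cast (by lia : 0 < Q).trans_le (le_criticalTime hZ)
  have hlog5 : Real.log 5 ≤ 2 := by
    have := Real.quadratic_le_exp_of_nonneg (by norm_num : (0 : ℝ) ≤ 2)
    rw [Real.log_le_iff_le_exp (by norm_num)]
    linarith
  have hmono : Real.log (Real.log Q / l / 5) ≤ Real.log (Q' / startTime Q Q') := by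
    rw [hstart]
    exact Real.log_le_log (by positivity) ((le_div_iff₀ hcrit).2 (by linarith))
  rw [Real.log_div (by positivity) (by norm_num)] at hmono
  linarith

/-- The second term telescopes along the denominators. It absorbs the case where
`log growthRatio` is of the order of `log Q`: then `log Q'` is larger than `log Q` by a constant
factor. -/
theorem growthWeight_le (hQ : 3 ≤ Q) (hQQ' : Q ≤ Q') :
    growthWeight Q Q' ≤ 2 / Real.log Q * Real.log (Q' / startTime Q Q') +
      4 * (Real.exp 4 + 1) * (1 / Real.log Q - 1 / Real.log Q') := by
  have hQ3 : (3 : ℝ) ≤ Q := by exact_mod_cast hQ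
  have hQQ'R : (Q : ℝ) ≤ Q' := by exact_mod_cast hQQ'
  have hlogQ := one_le_log_of_three_le hQ3
  have hstart0 : (0 : ℝ) < startTime Q Q' := by
    exact_mod_cast (by lia : 0 < Q).trans_le (le_startTime hQQ')
  have hlog : 0 ≤ Real.log (Q' / startTime Q Q') := Real.log_nonneg
    ((one_le_div hstart0).2 (by exact_mod_cast startTime_le hQQ'))
  have htel : 0 ≤ 1 / Real.log Q - 1 / Real.log Q' := sub_nonneg.2
    (one_div_le_one_div_of_le (by linarith) (Real.log_le_log (by linarith) hQQ'R))
  have hfirst : 0 ≤ 2 / Real.log Q * Real.log (Q' / startTime Q Q') := by positivity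
  have hlast : 0 ≤ 4 * (Real.exp 4 + 1) * (1 / Real.log Q - 1 / Real.log Q') := by positivity
  obtain hZ | hZ := lt_or_ge (growthRatio Q Q') 2
  · rw [growthWeight_of_growthRatio_lt_two (by linarith) hZ,
      ← Real.log_div (by linarith) (by linarith)]
    rw [startTime, if_pos hZ, div_mul_eq_mul_div] at hfirst ⊢
    rw [mul_div_assoc] at hfirst ⊢
    linarith
  rw [growthWeight_of_two_le_growthRatio (by linarith) hZ]
  set D := Real.log (Real.log Q) - Real.log (Real.log (growthRatio Q Q'))
  obtain hD4 | hD4 := lt_or_ge D 4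
  · linarith [max_one_div_log_le hQ3 hZ hD4]
  · rw [max_eq_right (by linarith)]
    refine le_add_of_le_of_nonneg ?_ hlast
    rw [div_mul_eq_mul_div]
    gcongr
    exact log_log_sub_log_log_le hQ hZ hD4

end StartTime

/-- The ball of radius `c / (N log q_n)` about `-N α`. At its points the term of index `N` along
the orbit exceeds a multiple, of the order of `1 / c`, of the sum of the previous terms, provided
`N` is a time between `startTime` and `q_{n+1}`. -/
def targetBall (α : ℝ) (q : ℕ → ℕ) (c : ℝ) (n N : ℕ) : Set UnitAddCircle :=
  Metric.closedBall (-(N • (α : UnitAddCircle))) (c / (N * Real.log (q n)))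

/-- The union of the target balls over the times from `startTime` up to `q_{n+1}`. -/
def targetSet (α : ℝ) (q : ℕ → ℕ) (c : ℝ) (n : ℕ) : Set UnitAddCircle :=
  ⋃ N ∈ Finset.Ico (startTime (q n) (q (n + 1))) (q (n + 1)), targetBall α q c n N

section Target

open MeasureTheory

variable {α c : ℝ} {p : ℕ → ℤ} {q : ℕ → ℕ} {n N : ℕ}

theorem mem_targetBall {x : UnitAddCircle} :
    x ∈ targetBall α q c n N ↔ ‖x + N • (α : UnitAddCircle)‖ ≤ c / (N * Real.log (q n)) := by
  rw [targetBall, Metric.mem_closedBall, dist_eq_norm, sub_neg_eq_add]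

theorem measurableSet_targetBall : MeasurableSet (targetBall α q c n N) :=
  Metric.isClosed_closedBall.measurableSet

theorem measurableSet_targetSet : MeasurableSet (targetSet α q c n) :=
  Finset.measurableSet_biUnion _ fun _ _ => measurableSet_targetBall

namespace IsConvergentSeq

theorem radius_le (H : IsConvergentSeq α p q) (hc : c ≤ 1 / 32) (hn : 3 ≤ q n)
    (hN : N ∈ Finset.Ico (startTime (q n) (q (n + 1))) (q (n + 1))) :
    c / (N * Real.log (q n)) ≤ 1 / (8 * q (n + 1)) := by
  rw [Finset.mem_Ico] at hN
  have hlogq := one_le_log_of_three_le (by exact_mod_cast hn : (3 : ℝ) ≤ q n)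
  have hq := H.cast_pos (n + 1)
  have hN0 : (0 : ℝ) < N := by
    exact_mod_cast (H.pos n).trans_le ((le_startTime (H.le_succ n)).trans hN.1)
  have hlog : 0 ≤ Real.log (N / q n + 1) :=
    Real.log_nonneg (le_add_of_nonneg_left (by positivity))
  have hle := mul_log_le_of_startTime_le hn (H.le_succ n) hN.1 hN.2
  have hprod : c * (8 * q (n + 1)) ≤ 1 / 32 * (8 * q (n + 1)) := by gcongr
  rw [div_le_div_iff₀ (by positivity) (by positivity)]
  linarith [mul_nonneg hq.le hlog]

theorem measureReal_targetBall (H : IsConvergentSeq α p q) (hc0 : 0 ≤ c) (hc : c ≤ 1 / 32)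
    (hn : 3 ≤ q n) (hN : N ∈ Finset.Ico (startTime (q n) (q (n + 1))) (q (n + 1))) :
    volume.real (targetBall α q c n N) = 2 * c / Real.log (q n) * (1 / N) := by
  have := Real.log_nonneg (H.one_le_cast n)
  have hr0 : 0 ≤ c / (N * Real.log (q n)) := by positivity
  have hr1 : c / (N * Real.log (q n)) ≤ 1 / 2 :=
    (H.radius_le hc hn hN).trans
      (one_div_le_one_div_of_le two_pos (by linarith [H.one_le_cast (n + 1)]))
  rw [Measure.real, targetBall, AddCircle.volume_closedBall, min_eq_right (by linarith),
    ENNReal.toReal_ofReal (by linarith), mul_div_assoc', div_mul_div_comm, mul_one,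
    mul_comm (N : ℝ)]

theorem pairwiseDisjoint_targetBall (H : IsConvergentSeq α p q) (hc : c ≤ 1 / 32)
    (hn : 3 ≤ q n) :
    (Finset.Ico (startTime (q n) (q (n + 1))) (q (n + 1)) : Set ℕ).PairwiseDisjoint
      (targetBall α q c n) := by
  intro i hi j hj hij
  refine Set.disjoint_left.2 fun x hxi hxj => ?_
  have hmem {k : ℕ} (hk : k ∈ Finset.Ico (startTime (q n) (q (n + 1))) (q (n + 1))) :
      k ∈ Set.Ico 0 (0 + q (n + 1)) := ⟨k.zero_le, by simpa using (Finset.mem_Ico.1 hk).2⟩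
  have hsep := H.pairwise_le_norm_sub n 0 x (hmem hi) (hmem hj) hij
  have hri := (mem_targetBall.1 hxi).trans (H.radius_le hc hn hi)
  have hrj := (mem_targetBall.1 hxj).trans (H.radius_le hc hn hj)
  have hpos : (0 : ℝ) < 1 / (8 * q (n + 1)) := by
    have := H.cast_pos (n + 1)
    positivity
  have hfour : 1 / (2 * q (n + 1) : ℝ) = 4 * (1 / (8 * q (n + 1))) := by
    field_simp
    norm_num
  linarith [norm_sub_le (x + i • (α : UnitAddCircle)) (x + j • (α : UnitAddCircle))]

theorem measureReal_targetSet_eq_sum (H : IsConvergentSeq α p q) (hc : c ≤ 1 / 32)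
    (hn : 3 ≤ q n) : volume.real (targetSet α q c n) =
      ∑ N ∈ Finset.Ico (startTime (q n) (q (n + 1))) (q (n + 1)),
        volume.real (targetBall α q c n N) :=
  measureReal_biUnion_finset (H.pairwiseDisjoint_targetBall hc hn)
    fun _ _ => measurableSet_targetBall

theorem measureReal_targetSet (H : IsConvergentSeq α p q) (hc0 : 0 ≤ c) (hc : c ≤ 1 / 32)
    (hn : 3 ≤ q n) : volume.real (targetSet α q c n) = 2 * c / Real.log (q n) *
      ∑ N ∈ Finset.Ico (startTime (q n) (q (n + 1))) (q (n + 1)), (1 : ℝ) / N := by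
  rw [H.measureReal_targetSet_eq_sum hc hn, Finset.mul_sum]
  exact Finset.sum_congr rfl fun N hN => H.measureReal_targetBall hc0 hc hn hN

theorem closedBall_inter_targetSet_subset (H : IsConvergentSeq α p q) (hc : c ≤ 1 / 32)
    (hn : 3 ≤ q n) (z : UnitAddCircle) (r : ℝ) :
    Metric.closedBall z r ∩ targetSet α q c n ⊆
      ⋃ N ∈ (Finset.Ico (startTime (q n) (q (n + 1))) (q (n + 1))).filter
        (fun N : ℕ => ‖z + N • (α : UnitAddCircle)‖ ≤ r + 1 / (8 * q (n + 1))),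
        targetBall α q c n N := by
  rintro x ⟨hxz, hx⟩
  obtain ⟨N, hN, hxN⟩ := Set.mem_iUnion₂.1 hx
  refine Set.mem_iUnion₂.2 ⟨N, Finset.mem_filter.2 ⟨hN, ?_⟩, hxN⟩
  have hball := (mem_targetBall.1 hxN).trans (H.radius_le hc hn hN)
  rw [Metric.mem_closedBall, dist_eq_norm] at hxz
  calc ‖z + N • (α : UnitAddCircle)‖ = ‖x + N • (α : UnitAddCircle) - (x - z)‖ := by
        congr 1
        abel
    _ ≤ r + 1 / (8 * q (n + 1)) := (norm_sub_le _ _).trans (by linarith)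

theorem measureReal_closedBall_inter_targetSet_le (H : IsConvergentSeq α p q) (hc0 : 0 ≤ c)
    (hc : c ≤ 1 / 32) (hn : 3 ≤ q (n + 2)) (z : UnitAddCircle) {r : ℝ} (hr : 0 ≤ r) :
    volume.real (Metric.closedBall z r ∩ targetSet α q c (n + 2)) ≤
      24 * (r + 2 / q (n + 1)) * volume.real (targetSet α q c (n + 2)) := by
  have hstart := startTime_le (H.le_succ (n + 2))
  obtain h | h := hstart.eq_or_lt
  · have hempty : targetSet α q c (n + 2) = ∅ := by simp [targetSet, h]
    simp [hempty]
  have := Real.log_nonneg (H.one_le_cast (n + 2))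
  have := H.cast_pos (n + 1)
  set P := startTime (q (n + 2)) (q (n + 2 + 1))
  set R := r + 1 / (8 * q (n + 2 + 1)) with hR
  have hRle : R ≤ r + 1 / q (n + 1) := by
    have : (q (n + 1) : ℝ) ≤ q (n + 2 + 1) := by exact_mod_cast H.monotone (by lia)
    rw [hR]
    gcongr
    linarith
  have hvisits := H.sum_filter_norm_le_one_div_le n z (R := R) (by positivity)
    ((H.le_succ (n + 1)).trans (le_startTime (H.le_succ (n + 2))))
    (Nat.le_sub_of_add_le' (startTime_add_le ((add_comm _ _).trans_le (H.add_le (n + 1)))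
      (H.two_mul_le (n + 1)) h))
  rw [Nat.add_sub_cancel' hstart] at hvisits
  set F := (Finset.Ico P (q (n + 2 + 1))).filter
    fun N : ℕ => ‖z + N • (α : UnitAddCircle)‖ ≤ R
  calc volume.real (Metric.closedBall z r ∩ targetSet α q c (n + 2))
      ≤ volume.real (⋃ N ∈ F, targetBall α q c (n + 2) N) :=
        measureReal_mono (H.closedBall_inter_targetSet_subset hc hn z r) (measure_ne_top _ _)
    _ ≤ ∑ N ∈ F, volume.real (targetBall α q c (n + 2) N) := measureReal_biUnion_finset_le _ _
    _ = 2 * c / Real.log (q (n + 2)) * ∑ N ∈ F, (1 : ℝ) / N := by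
        rw [Finset.mul_sum]
        exact Finset.sum_congr rfl fun N hN =>
          H.measureReal_targetBall hc0 hc hn (Finset.mem_filter.1 hN).1
    _ ≤ 2 * c / Real.log (q (n + 2)) * (24 * (r + 1 / q (n + 1) + 1 / q (n + 1)) *
          ∑ N ∈ Finset.Ico P (q (n + 2 + 1)), (1 : ℝ) / N) := by
        gcongr
        exact hvisits.trans (by gcongr)
    _ = 24 * (r + 2 / q (n + 1)) * volume.real (targetSet α q c (n + 2)) := by
        rw [H.measureReal_targetSet hc0 hc hn]
        ring

theorem measureReal_targetSet_inter_le (H : IsConvergentSeq α p q) (hc0 : 0 ≤ c)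
    (hc : c ≤ 1 / 32) {m : ℕ} (hm : 3 ≤ q m) (hn : 3 ≤ q (n + 2)) :
    volume.real (targetSet α q c m ∩ targetSet α q c (n + 2)) ≤
      (12 * volume.real (targetSet α q c m) + 48 * (q (m + 1) / q (n + 1))) *
        volume.real (targetSet α q c (n + 2)) := by
  have := Real.log_nonneg (H.one_le_cast m)
  set I := Finset.Ico (startTime (q m) (q (m + 1))) (q (m + 1)) with hI
  set s := volume.real (targetSet α q c (n + 2)) with hs
  have hball {M : ℕ} (hM : M ∈ I) : volume.real (targetBall α q c m M ∩ targetSet α q c (n + 2)) ≤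
      12 * s * volume.real (targetBall α q c m M) + 48 / q (n + 1) * s := by
    refine (H.measureReal_closedBall_inter_targetSet_le hc0 hc hn _ (by positivity)).trans_eq ?_
    rw [H.measureReal_targetBall hc0 hc hm hM, ← hs]
    have hM0 : (0 : ℝ) < M := by
      exact_mod_cast (H.pos m).trans_le
        ((le_startTime (H.le_succ m)).trans (Finset.mem_Ico.1 hM).1)
    have := H.cast_pos (n + 1)
    field_simp
    ring
  calc volume.real (targetSet α q c m ∩ targetSet α q c (n + 2))
      = volume.real (⋃ M ∈ I, targetBall α q c m M ∩ targetSet α q c (n + 2)) := by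
        rw [← Set.iUnion₂_inter]
        rfl
    _ ≤ ∑ M ∈ I, volume.real (targetBall α q c m M ∩ targetSet α q c (n + 2)) :=
        measureReal_biUnion_finset_le _ _
    _ ≤ ∑ M ∈ I, (12 * s * volume.real (targetBall α q c m M) + 48 / q (n + 1) * s) :=
        Finset.sum_le_sum fun M hM => hball hM
    _ = 12 * s * volume.real (targetSet α q c m) + I.card * (48 / q (n + 1) * s) := by
        rw [Finset.sum_add_distrib, ← Finset.mul_sum, Finset.sum_const, nsmul_eq_mul,
          H.measureReal_targetSet_eq_sum hc hm]
    _ ≤ 12 * s * volume.real (targetSet α q c m) + q (m + 1) * (48 / q (n + 1) * s) := by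
        gcongr
        rw [hI, Nat.card_Ico]
        exact Nat.sub_le _ _
    _ = _ := by ring

theorem sum_range_add_le (H : IsConvergentSeq α p q) (k n : ℕ) :
    ∑ i ∈ Finset.range n, q (i + k + 2) ≤ q (n + k) + 2 * q (n + k + 1) := by
  induction n with
  | zero => simp
  | succ n ih =>
    rw [Finset.sum_range_succ, add_right_comm n 1 k]
    linarith [H.add_le (n + k)]

theorem sum_measureReal_targetSet_inter_le (H : IsConvergentSeq α p q) (hc0 : 0 ≤ c)
    (hc : c ≤ 1 / 32) (j : ℕ) :
    ∑ i ∈ Finset.range j, volume.real (targetSet α q c (i + 3) ∩ targetSet α q c (j + 3)) ≤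
      145 * (∑ i ∈ Finset.range j, volume.real (targetSet α q c (i + 3)) + 1) *
        volume.real (targetSet α q c (j + 3)) := by
  cases j with
  | zero => simp
  | succ j =>
    have hq3 (i : ℕ) : 3 ≤ q (i + 3) := le_add_self.trans (H.le_self (i + 3))
    have hq := H.cast_pos (j + 3)
    set s := volume.real (targetSet α q c (j + 1 + 3))
    set t := volume.real (targetSet α q c (j + 3))
    set S := ∑ i ∈ Finset.range j, volume.real (targetSet α q c (i + 3)) with hS
    have : 0 ≤ s := measureReal_nonneg
    have ht0 : 0 ≤ t := measureReal_nonneg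
    have hS0 : 0 ≤ S := Finset.sum_nonneg fun _ _ => measureReal_nonneg
    have hlast : volume.real (targetSet α q c (j + 3) ∩ targetSet α q c (j + 1 + 3)) ≤ s :=
      measureReal_mono Set.inter_subset_right (measure_ne_top _ _)
    have hterm (i : ℕ) : volume.real (targetSet α q c (i + 3) ∩ targetSet α q c (j + 1 + 3)) ≤
        (12 * volume.real (targetSet α q c (i + 3)) + 48 * (q (i + 3 + 1) / q (j + 3))) * s :=
      H.measureReal_targetSet_inter_le hc0 hc (hq3 i) (hq3 (j + 1))
    have hsum : ∑ i ∈ Finset.range j, (q (i + 3 + 1) : ℝ) ≤ 3 * q (j + 3) := by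
      have := H.sum_range_add_le 2 j
      have := H.le_succ (j + 2)
      exact_mod_cast (by lia : ∑ i ∈ Finset.range j, q (i + 3 + 1) ≤ 3 * q (j + 3))
    rw [Finset.sum_range_succ, Finset.sum_range_succ]
    calc _ ≤ ∑ i ∈ Finset.range j, (12 * volume.real (targetSet α q c (i + 3)) +
            48 * (q (i + 3 + 1) / q (j + 3))) * s + s :=
          add_le_add (Finset.sum_le_sum fun i _ => hterm i) hlast
      _ = 12 * S * s + 48 * s / q (j + 3) * ∑ i ∈ Finset.range j, (q (i + 3 + 1) : ℝ) + s := by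
          rw [← Finset.sum_mul, Finset.sum_add_distrib, ← Finset.mul_sum, ← Finset.mul_sum,
            ← Finset.sum_div, hS]
          ring
      _ ≤ 12 * S * s + 48 * s / q (j + 3) * (3 * q (j + 3)) + s := by gcongr
      _ = (12 * S + 145) * s := by
          field_simp
          ring
      _ ≤ 145 * (S + t + 1) * s := by
          gcongr
          linarith

end IsConvergentSeq

end Target

section Divergence

open Filter MeasureTheory

namespace IsConvergentSeq

variable {α : ℝ} {p : ℕ → ℤ} {q : ℕ → ℕ}

theorem summable_one_div_log_sub (H : IsConvergentSeq α p q) :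
    Summable fun i => 1 / Real.log (q (i + 3)) - 1 / Real.log (q (i + 4)) := by
  have hlog (i : ℕ) : 1 ≤ Real.log (q (i + 3)) :=
    one_le_log_of_three_le (by exact_mod_cast le_add_self.trans (H.le_self (i + 3)))
  refine summable_of_sum_range_le (c := 1 / Real.log (q 3)) (fun i => sub_nonneg.2 ?_) fun n => ?_
  · exact one_div_le_one_div_of_le (by linarith [hlog i])
      (Real.log_le_log (H.cast_pos _) (by exact_mod_cast H.le_succ (i + 3)))
  · rw [Finset.sum_range_sub' fun i => 1 / Real.log (q (i + 3))]
    exact sub_le_self _ (one_div_nonneg.2 (by linarith [hlog n]))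

theorem not_summable_measureReal_targetSet (H : IsConvergentSeq α p q) {c : ℝ} (hc0 : 0 < c)
    (hc : c ≤ 1 / 32) (hdiv : ¬Summable fun n => growthWeight (q n) (q (n + 1))) :
    ¬Summable fun i => volume.real (targetSet α q c (i + 3)) := by
  refine fun hsum => hdiv ((summable_nat_add_iff 3).1 ?_)
  refine ((hsum.mul_left (1 / c)).add
    (H.summable_one_div_log_sub.mul_left (4 * (Real.exp 4 + 1)))).of_nonneg_of_le
    (fun i => H.growthWeight_succ_nonneg (i + 3)) fun i => ?_
  have hi : 3 ≤ q (i + 3) := le_add_self.trans (H.le_self (i + 3))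
  have := Real.log_nonneg (H.one_le_cast (i + 3))
  have hlog := log_div_le_sum_Ico_one_div
    ((H.pos (i + 3)).trans_le (le_startTime (H.le_succ (i + 3))))
    (startTime_le (H.le_succ (i + 3)))
  calc growthWeight (q (i + 3)) (q (i + 3 + 1))
      ≤ 2 / Real.log (q (i + 3)) * Real.log (q (i + 3 + 1) / startTime (q (i + 3)) (q (i + 3 + 1)))
        + 4 * (Real.exp 4 + 1) * (1 / Real.log (q (i + 3)) - 1 / Real.log (q (i + 3 + 1))) :=
        growthWeight_le hi (H.le_succ (i + 3))
    _ ≤ 1 / c * volume.real (targetSet α q c (i + 3)) +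
          4 * (Real.exp 4 + 1) * (1 / Real.log (q (i + 3)) - 1 / Real.log (q (i + 3 + 1))) := by
        rw [H.measureReal_targetSet hc0.le hc hi, ← mul_assoc,
          show 1 / c * (2 * c / Real.log (q (i + 3))) = 2 / Real.log (q (i + 3)) by field_simp]
        gcongr

theorem mul_birkhoffSum_le_phi_of_mem_targetBall (H : IsConvergentSeq α p q) {C : ℝ} (hC : 1 ≤ C)
    {n N : ℕ} (hn : 3 ≤ q (n + 1))
    (hN : N ∈ Finset.Ico (startTime (q (n + 1)) (q (n + 2))) (q (n + 2))) {x : UnitAddCircle}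
    (hx0 : x + N • (α : UnitAddCircle) ≠ 0) (hx : x ∈ targetBall α q (1 / (128 * C)) (n + 1) N) :
    C * birkhoffSum (torusRotation α) phi N x ≤ phi (x + N • (α : UnitAddCircle)) := by
  have hlog := one_le_log_of_three_le (by exact_mod_cast hn : (3 : ℝ) ≤ q (n + 1))
  have hrad := H.radius_le (one_div_le_one_div_of_le (by norm_num)
    (by linarith : 32 ≤ 128 * C)) hn hN
  have hball := mem_targetBall.1 hx
  obtain ⟨hstart, hNq⟩ := Finset.mem_Ico.1 hN
  have hqN := (le_startTime (H.le_succ (n + 1))).trans hstart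
  have hN0 : (0 : ℝ) < N := by exact_mod_cast (H.pos (n + 1)).trans_le hqN
  have hq := H.cast_pos (n + 2)
  have hsum := H.birkhoffSum_le n hqN hNq ((hball.trans hrad).trans
    (one_div_le_one_div_of_le (by positivity) (by linarith)))
  have hclose := mul_log_le_of_startTime_le hn (H.le_succ (n + 1)) hstart hNq
  have hnorm := norm_pos_iff.2 hx0
  calc C * birkhoffSum (torusRotation α) phi N x
      ≤ C * (128 * (N * Real.log (q (n + 1)))) := by
        gcongr
        nlinarith
    _ = 1 / (1 / (128 * C) / (N * Real.log (q (n + 1)))) := by field_simp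
    _ ≤ 1 / ‖x + N • (α : UnitAddCircle)‖ := one_div_le_one_div_of_le hnorm hball
    _ ≤ phi (x + N • (α : UnitAddCircle)) := one_div_norm_le_phi hx0

theorem frequently_mul_birkhoffSum_le_phi (H : IsConvergentSeq α p q) {C : ℝ} (hC : 1 ≤ C)
    {x : UnitAddCircle} (hx0 : ∀ k : ℕ, x + k • (α : UnitAddCircle) ≠ 0)
    (hx : x ∈ limsup (fun i => targetSet α q (1 / (128 * C)) (i + 3)) atTop) :
    ∃ᶠ N in atTop,
      C * birkhoffSum (torusRotation α) phi N x ≤ phi (x + N • (α : UnitAddCircle)) := by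
  rw [mem_limsup_iff_frequently_mem, frequently_atTop] at hx
  refine frequently_atTop.2 fun a => ?_
  obtain ⟨i, hi, hmem⟩ := hx a
  obtain ⟨N, hN, hxN⟩ := Set.mem_iUnion₂.1 hmem
  refine ⟨N, ?_, H.mul_birkhoffSum_le_phi_of_mem_targetBall (n := i + 2) hC
    (le_add_self.trans (H.le_self (i + 3))) hN (hx0 N) hxN⟩
  calc a ≤ i + 3 := hi.trans (i.le_add_right 3)
    _ ≤ q (i + 3) := H.le_self (i + 3)
    _ ≤ startTime (q (i + 3)) (q (i + 3 + 1)) := le_startTime (H.le_succ (i + 3))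
    _ ≤ N := (Finset.mem_Ico.1 hN).1

end IsConvergentSeq

/-- The sum of the first `k` terms is absorbed by the extra unit in the factor `C + 1`, since
`phi ≥ 1`. -/
theorem frequently_mul_birkhoffSum_le_phi_of_iterate {f : UnitAddCircle → UnitAddCircle} (k : ℕ)
    {C : ℝ} {x : UnitAddCircle}
    (h : ∃ᶠ N in atTop, (C + 1) * birkhoffSum f phi N (f^[k] x) ≤ phi (f^[N] (f^[k] x))) :
    ∃ᶠ N in atTop, C * birkhoffSum f phi N x ≤ phi (f^[N] x) := by
  obtain ⟨M, hM⟩ := exists_nat_ge (C * birkhoffSum f phi k x)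
  have hlarge := h.and_eventually (eventually_ge_atTop M)
  refine (tendsto_add_atTop_nat k).frequently (hlarge.mono fun N ⟨_, hMN⟩ => ?_)
  have hsum := natCast_le_birkhoffSum_phi f N (f^[k] x)
  have hMN' : (M : ℝ) ≤ N := by exact_mod_cast hMN
  rw [add_comm N k, birkhoffSum_add, add_comm k N, Function.iterate_add_apply]
  linarith

theorem ae_exists_iterate_mem {X : Type*} [MeasurableSpace X] {μ : Measure X} [IsFiniteMeasure μ]
    {f : X → X} (hf : Ergodic f μ) {s : Set X} (hs : MeasurableSet s) (hpos : 0 < μ s) :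
    ∀ᵐ x ∂μ, ∃ k, f^[k] x ∈ s := by
  set U : Set X := ⋃ k, f^[k] ⁻¹' s
  have hU : MeasurableSet U := .iUnion fun k => hf.measurable.iterate k hs
  have hsub : f ⁻¹' U ⊆ U := fun x hx => by
    obtain ⟨k, hk⟩ := Set.mem_iUnion.1 hx
    exact Set.mem_iUnion.2 ⟨k + 1, hk⟩
  obtain h | h :=
    hf.ae_empty_or_univ_of_preimage_ae_le hU.nullMeasurableSet hsub.eventuallyLE
  · exact absurd (measure_mono_null (Set.subset_iUnion _ 0) (ae_eq_empty.1 h)) hpos.ne'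
  · filter_upwards [eventuallyEq_univ.1 h] with x hx
    exact Set.mem_iUnion.1 hx

theorem ergodic_torusRotation {α : ℝ} (hα : Irrational α) : Ergodic (torusRotation α) := by
  refine AddCircle.ergodic_add_right.2 (AddCircle.denseRange_zsmul_iff.1 ?_)
  simpa [AddCircle.denseRange_zsmul_coe_iff] using hα

theorem extravagance_eq_top {α : ℝ} {x : UnitAddCircle}
    (h : ∀ m : ℕ, ∃ᶠ N in atTop, m * birkhoffSum (torusRotation α) phi N x ≤
      phi ((torusRotation α)^[N] x)) : extravagance α x = ⊤ := by
  refine EReal.eq_top_iff_forall_lt _ |>.2 fun y => ?_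
  obtain ⟨m, hm⟩ := exists_nat_gt y
  refine (EReal.coe_lt_coe_iff.2 hm).trans_le (le_limsup_of_frequently_le ?_)
  refine ((h m).and_eventually (eventually_gt_atTop 0)).mono fun N ⟨hN, hN0⟩ => ?_
  have hsum : 0 < birkhoffSum (torusRotation α) phi N x :=
    (Nat.cast_pos.2 hN0).trans_le (natCast_le_birkhoffSum_phi _ N x)
  exact EReal.coe_le_coe_iff.2 ((le_div_iff₀ hsum).2 hN)

theorem IsConvergentSeq.ae_frequently_mul_birkhoffSum_le_phi {α : ℝ} {p : ℕ → ℤ} {q : ℕ → ℕ}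
    (H : IsConvergentSeq α p q) (hα : Irrational α)
    (hdiv : ¬Summable fun n => growthWeight (q n) (q (n + 1))) {C : ℝ} (hC : 0 ≤ C) :
    ∀ᵐ x : UnitAddCircle, ∃ᶠ N in atTop,
      C * birkhoffSum (torusRotation α) phi N x ≤ phi ((torusRotation α)^[N] x) := by
  set c := 1 / (128 * (C + 1))
  have hc0 : 0 < c := by positivity
  have hc32 : c ≤ 1 / 32 := one_div_le_one_div_of_le (by norm_num) (by linarith)
  have hpos : 0 < volume (limsup (fun i => targetSet α q c (i + 3)) atTop) :=
    measure_limsup_atTop_pos (fun _ => measurableSet_targetSet)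
      (H.not_summable_measureReal_targetSet hc0 hc32 hdiv) (by norm_num)
      (H.sum_measureReal_targetSet_inter_le hc0.le hc32)
  have hmeas := MeasurableSet.measurableSet_limsup fun i =>
    measurableSet_targetSet (α := α) (q := q) (c := c) (n := i + 3)
  filter_upwards [ae_forall_add_nsmul_ne_zero (α : UnitAddCircle),
    ae_exists_iterate_mem (ergodic_torusRotation hα) hmeas hpos] with x hx0 ⟨k, hk⟩
  refine frequently_mul_birkhoffSum_le_phi_of_iterate k ?_
  simp only [torusRotation_iterate] at hk ⊢
  refine H.frequently_mul_birkhoffSum_le_phi (by linarith) (fun j => ?_) hk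
  rw [add_assoc, ← add_smul]
  exact hx0 (k + j)

theorem IsConvergentSeq.ae_extravagance_eq_top {α : ℝ} {p : ℕ → ℤ} {q : ℕ → ℕ}
    (H : IsConvergentSeq α p q) (hα : Irrational α)
    (hdiv : ¬Summable fun n => growthWeight (q n) (q (n + 1))) :
    ∀ᵐ x : UnitAddCircle, extravagance α x = ⊤ := by
  filter_upwards [ae_all_iff.2 fun m : ℕ =>
    H.ae_frequently_mul_birkhoffSum_le_phi hα hdiv m.cast_nonneg] with x hx
  exact extravagance_eq_top hx

end Divergence

theorem mainTheorem1_general (α : ℝ) (hα : Irrational α) :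
    ((Summable fun n : ℕ => W α (n + 1)) → ∀ᵐ x : UnitAddCircle, extravagance α x = 0) ∧
      ((¬ Summable fun n : ℕ => W α (n + 1)) →
        ∀ᵐ x : UnitAddCircle, extravagance α x = ⊤) := by
  obtain ⟨p, q, H, hq⟩ := exists_isConvergentSeq hα
  have hW : (Summable fun n : ℕ => W α (n + 1)) ↔
      Summable fun n => growthWeight (q n) (q (n + 1)) := by
    rw [← summable_nat_add_iff (f := fun n => growthWeight (q n) (q (n + 1))) 1]
    simp only [← hq]
    rfl
  rw [hW]
  exact ⟨H.ae_extravagance_eq_zero, H.ae_extravagance_eq_top hα⟩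

theorem mainTheorem1 (α : ℝ) (hα : Irrational α) (hα01 : α ∈ Set.Ioo (0 : ℝ) 1) :
    ((Summable fun n : ℕ => W α (n + 1)) →
      ∀ᵐ x : UnitAddCircle, extravagance α x = 0) ∧
    ((¬ Summable fun n : ℕ => W α (n + 1)) →
      ∀ᵐ x : UnitAddCircle, extravagance α x = ⊤) :=
  mainTheorem1_general α hα
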